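/- Let $\mathcal F=(Q,\mathcal R)$ be a range space, i.e. a (multi-)family $\mathcal R$ of subsets ("ranges") of a set $Q$, where $Q$ and $\mathcal R$ are standard Borel spaces (for instance Borel subsets of $\mathbb R^k$) and $\{(q,R): q\in R\}$ is a Borel subset of $Q\times\mathcal R$. Let $w_0\neq 0$ be a finite measure on $\mathcal R$. Assume that $\mathcal F$ has VC-dimension at most $d$, where $d\ge 1$, and that there is a finite hitting set (a set of points that meets every range). Let $\textsc{Opt}_{\mathcal F}$ be the minimum size of a hitting set, and let $z^*_{\mathcal F}$ be the infimum of $\mu(Q)$ over all measures $\mu$ on $Q$ with $\mu(R)\ge 1$ for all $R\in\mathcal R$. Let $g_{\mathcal F^*}(r)$ be the largest number of distinct families of the form $\{R\in\mathcal R': q\in R\}$, $q\in Q$, over all $\mathcal R'\subseteq\mathcal R$ with $|\mathcal R'|\le r$. Inside the bounds below $\log x$ means $\max\{1,\ln x\}$. The computational model is the unit-cost real RAM that can choose uniformly random integers, can test whether a given point lies in a given range, and has three oracles. (i) The dual subsystem oracle lists, for a finite family $\mathcal R'$ of ranges, all distinct families $\{R\in\mathcal R':q\in R\}$, $q\in Q$,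 together with their cardinalities. (ii) The point-in oracle returns, for a finite family of ranges, a point common to all of them, if there is one. (iii) The sampling oracle draws independent ranges from the normalization of the measure with density $R\mapsto\varphi(|P\cap R|)$ with respect to $w_0$, where the finite multiset $P\subseteq Q$ and the table $\varphi\ge 0$ of weights are given by the algorithm. Every elementary operation and every oracle call costs one step, and in addition each family listed by the dual subsystem oracle costs one step; the number of ranges drawn by the sampling oracle is counted separately. Then there are a randomized algorithm (one program for all range spaces) and an absolute constant $C>0$ such that the following holds for all such $\mathcal F$, $w_0$, $d$, all valid oracles (i) and (ii) and all $\varepsilon,\delta\in(0,1)$. Put $$K:=\frac{d}{\varepsilon^3(1-\varepsilon)}\log\frac d\varepsilon\cdot\textsc{Opt}_{\mathcal F}\log\frac{\textsc{Opt}_{\mathcal F}}{\varepsilon\delta(1-\varepsilon)},\qquad N:=\frac{d\,2^d\,\textsc{Opt}_{\mathcal F}^2}{\varepsilon^2}\log\frac{\textsc{Opt}_{\mathcal F}}{\varepsilon}.$$ On input $d,\varepsilon,\delta$ (and without knowing $\textsc{Opt}_{\mathcal F}$ or $z^*_{\mathcal F}$), with probability at least $2/3$ the algorithm halts with a set of at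 most $C\,d\,z^*_{\mathcal F}\log(d\,z^*_{\mathcal F})$ points that hits a subset of $\mathcal R$ of measure at least $(1-\delta)\,w_0(\mathcal R)$, after at most $C\cdot K\cdot g_{\mathcal F^*}(\lceil C N\rceil)$ steps, in which at most $C\cdot K\cdot N$ ranges are drawn. If moreover infinitely many families $\{R\in\mathcal R:q\in R\}$, $q\in Q$, are distinct, then the number of steps and the number of drawn ranges together are at most $C\cdot K\cdot g_{\mathcal F^*}(\lceil CN\rceil)$. -/

import Mathlib

open MeasureTheory
open scoped ENNReal

universe u v

noncomputable section

namespace HittingSet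

/-! ## Range spaces -/

/-- A range space: a family of subsets (ranges) of the ground set `Q`, indexed by `ι`.
The same subset may occur under several labels, so the ranges form a multiset. -/
structure RangeSpace (Q : Type u) (ι : Type v) where
  range : ι → Set Q

namespace RangeSpace

variable {Q : Type u} {ι : Type v}

/-- The dual range space: its points are the ranges of `F`, and its ranges are the sets
`{R | q ∈ R}` for `q ∈ Q`. -/
def dual (F : RangeSpace Q ι) : RangeSpace ι Q where
  range q := {i | q ∈ F.range i}

/-- The projection of the ranges onto a finite set of points. -/
def traces (F : RangeSpace Q ι) (P : Finset Q) : Set (Set Q) :=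
  {A | ∃ i, A = F.range i ∩ (P : Set Q)}

/-- `P` is shattered: every subset of `P` is the intersection of `P` with a range. -/
def Shatters (F : RangeSpace Q ι) (P : Finset Q) : Prop :=
  ∀ A : Set Q, A ⊆ (P : Set Q) → A ∈ F.traces P

/-- The VC-dimension: the largest cardinality of a shattered finite set of points. -/
def vcDim (F : RangeSpace Q ι) : ℕ∞ :=
  ⨆ (P : Finset Q) (_ : F.Shatters P), (P.card : ℕ∞)

/-- The growth (shatter) function `g_F`: the smallest integer that bounds the number of
distinct traces on a set of at most `r` points. -/
def growth (F : RangeSpace Q ι) (r : ℕ) : ℕ :=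
  sInf {m | ∀ P : Finset Q, P.card ≤ r → (F.traces P).encard ≤ (m : ℕ∞)}

/-- `H` meets every range. -/
def IsHittingSet (F : RangeSpace Q ι) (H : Set Q) : Prop :=
  ∀ i, (H ∩ F.range i).Nonempty

/-- The minimum size of a hitting set (meaningful when a finite hitting set exists). -/
def opt (F : RangeSpace Q ι) : ℕ :=
  sInf {n | ∃ H : Finset Q, F.IsHittingSet (H : Set Q) ∧ H.card = n}

/-- The ranges hit by at least one point of a list. -/
def hitBy (F : RangeSpace Q ι) (L : List Q) : Set ι :=
  {i | ∃ q ∈ L, q ∈ F.range i}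

/-- The incidence relation between points and ranges is measurable. -/
def MeasurableIncidence [MeasurableSpace Q] [MeasurableSpace ι] (F : RangeSpace Q ι) : Prop :=
  MeasurableSet {x : Q × ι | x.1 ∈ F.range x.2}

/-- The value `z*` of the fractional hitting set problem: the least total mass of a measure on
`Q` that gives mass at least one to every range. -/
def fractionalOpt [MeasurableSpace Q] (F : RangeSpace Q ι) : ℝ :=
  (⨅ (μ : Measure Q) (_ : ∀ i, 1 ≤ μ (F.range i)), μ Set.univ).toReal

open scoped Classical in
/-- The number of points of the list `P`, with multiplicity, that lie in the range `i`. -/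
def hits (F : RangeSpace Q ι) (P : List Q) (i : ι) : ℕ :=
  P.countP (fun q => decide (q ∈ F.range i))

open scoped Classical in
/-- The sublist of those ranges of `L` that contain `q`. -/
def through (F : RangeSpace Q ι) (L : List ι) (q : Q) : List ι :=
  L.filter (fun i => decide (q ∈ F.range i))

end RangeSpace

variable {Q : Type u} {ι : Type v}

/-! ## Oracles -/

/-- The two deterministic oracles.  `subsys L` lists, without repetition, all subfamilies
`{R ∈ L | q ∈ R}` of the finite family `L`, for `q ∈ Q`; `pointIn L` returns a point common to all
ranges of `L` if there is one.  How the list is ordered and which point is returned is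
arbitrary. -/
structure Oracles (F : RangeSpace Q ι) where
  subsys : List ι → List (List ι)
  subsys_nodup : ∀ L, (subsys L).Nodup
  mem_subsys : ∀ L A, A ∈ subsys L ↔ ∃ q, A = F.through L q
  pointIn : List ι → Option Q
  pointIn_some : ∀ L q, pointIn L = some q → ∀ i ∈ L, q ∈ F.range i
  pointIn_none : ∀ L, pointIn L = none → ¬ ∃ q, ∀ i ∈ L, q ∈ F.range i

/-- The finite measure with density `R ↦ φ |P ∩ R|` with respect to `w₀`, for a finite multiset
`P` of points and a table `φ` of weights. -/
def reweight [MeasurableSpace ι] (F : RangeSpace Q ι) (w₀ : Measure ι) (P : List Q) (φ : ℕ → ℝ) :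
    Measure ι :=
  w₀.withDensity (fun i => ENNReal.ofReal (φ (F.hits P i)))

/-! ## A randomized real RAM with oracles

Programs are finite pieces of syntax and do not depend on the range space.  The machine has a
memory of natural numbers and a memory of real numbers (both with indirect addressing, exact
arithmetic and unit cost), and finitely many named lists of points, lists of ranges and lists
of families of ranges. -/

/-- Expressions of natural number type. -/
inductive NExp where
  | const (n : ℕ)
  | load (a : NExp)
  | add (x y : NExp)
  | sub (x y : NExp)
  | mul (x y : NExp)
  /-- the length of a list of points -/
  | numPts (p : ℕ)
  /-- the length of a list of ranges -/
  | numRgs (r : ℕ)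
  /-- the number of families in a list of families -/
  | numFam (f : ℕ)
  /-- the number of ranges in the `k`-th family of a list of families -/
  | cardFam (f : ℕ) (k : NExp)

/-- Expressions of real type. -/
inductive RExp where
  | const (c : ℚ)
  | load (a : NExp)
  | ofNat (x : NExp)
  | add (x y : RExp)
  | sub (x y : RExp)
  | mul (x y : RExp)
  | div (x y : RExp)

/-- Tests. -/
inductive BExp where
  | ltN (x y : NExp)
  | ltR (x y : RExp)
  /-- does the `j`-th point of the list `p` lie in the `k`-th range of the list `r`? -/
  | mem (p : ℕ) (j : NExp) (r : ℕ) (k : NExp)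
  | neg (b : BExp)
  | conj (b c : BExp)

/-- Programs. -/
inductive Cmd where
  | setNat (a e : NExp)
  | setReal (a : NExp) (e : RExp)
  /-- empty the list of points `p` -/
  | clear (p : ℕ)
  /-- append the `j`-th point of the list `p'` to the list `p` -/
  | push (p p' : ℕ) (j : NExp)
  /-- store at address `a` a uniformly random element of `{0, …, n}` -/
  | rand (a n : NExp)
  /-- sampling oracle: overwrite the list `r` by `m` independent ranges, drawn from the measure
  that is defined by the list of points `p` and the weights stored from address `base` on -/
  | sample (r p : ℕ) (base m : NExp)
  /-- dual subsystem oracle on the list of ranges `r`, the answer is stored in `f` -/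
  | subsys (f r : ℕ)
  /-- point-in oracle on the `k`-th family of `f`; a point, if returned, is appended to `p` -/
  | pointIn (p f : ℕ) (k : NExp)
  | seq (c₁ c₂ : Cmd)
  | branch (b : BExp) (c₁ c₂ : Cmd)
  | loop (b : BExp) (c : Cmd)

/-- Configurations of the machine, with two counters: the number `steps` of elementary steps
done and the number `draws` of ranges drawn by the sampling oracle so far. -/
structure State (Q : Type u) (ι : Type v) where
  nat : ℕ → ℕ
  real : ℕ → ℝ
  pts : ℕ → List Q
  rgs : ℕ → List ι
  fam : ℕ → List (List ι)
  steps : ℕ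
  draws : ℕ

namespace State

/-- Charge `k` elementary steps. -/
def tick (s : State Q ι) (k : ℕ) : State Q ι := { s with steps := s.steps + k }

def setNat (s : State Q ι) (a n : ℕ) : State Q ι := { s with nat := Function.update s.nat a n }

def setReal (s : State Q ι) (a : ℕ) (x : ℝ) : State Q ι :=
  { s with real := Function.update s.real a x }

def setPts (s : State Q ι) (p : ℕ) (L : List Q) : State Q ι :=
  { s with pts := Function.update s.pts p L }

def setRgs (s : State Q ι) (r : ℕ) (L : List ι) : State Q ι :=
  { s with rgs := Function.update s.rgs r L }

def setFam (s : State Q ι) (f : ℕ) (A : List (List ι)) : State Q ι :=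
  { s with fam := Function.update s.fam f A }

def addDraws (s : State Q ι) (m : ℕ) : State Q ι := { s with draws := s.draws + m }

/-- The initial configuration: real cells `0` and `1` hold `ε` and `δ`, the natural number cell
`0` holds `d`, and everything else is zero or empty. -/
def init (d : ℕ) (ε δ : ℝ) : State Q ι where
  nat := fun a => if a = 0 then d else 0
  real := fun a => if a = 0 then ε else if a = 1 then δ else 0
  pts := fun _ => []
  rgs := fun _ => []
  fam := fun _ => []
  steps := 0
  draws := 0

/-- The output is the list of points number `0`. -/
def output (s : State Q ι) : List Q := s.pts 0

end State

def NExp.eval (s : State Q ι) : NExp → ℕ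
  | .const n => n
  | .load a => s.nat (a.eval s)
  | .add x y => x.eval s + y.eval s
  | .sub x y => x.eval s - y.eval s
  | .mul x y => x.eval s * y.eval s
  | .numPts p => (s.pts p).length
  | .numRgs r => (s.rgs r).length
  | .numFam f => (s.fam f).length
  | .cardFam f k => ((s.fam f).getD (k.eval s) []).length

def RExp.eval (s : State Q ι) : RExp → ℝ
  | .const c => (c : ℝ)
  | .load a => s.real (a.eval s)
  | .ofNat x => (x.eval s : ℝ)
  | .add x y => x.eval s + y.eval s
  | .sub x y => x.eval s - y.eval s
  | .mul x y => x.eval s * y.eval s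
  | .div x y => x.eval s / y.eval s

def BExp.eval (F : RangeSpace Q ι) (s : State Q ι) : BExp → Prop
  | .ltN x y => x.eval s < y.eval s
  | .ltR x y => x.eval s < y.eval s
  | .mem p j r k =>
      ∃ q ∈ (s.pts p)[j.eval s]?, ∃ i ∈ (s.rgs r)[k.eval s]?, q ∈ F.range i
  | .neg b => ¬ b.eval F s
  | .conj b c => b.eval F s ∧ c.eval F s

/-- The expectation of `f` over the result of drawing `m` independent ranges from the
normalization of the finite measure `μ`; if `μ` is zero then nothing is drawn. -/
def drawExp [MeasurableSpace ι] (μ : Measure ι) (m : ℕ) (f : List ι → ℝ≥0∞) : ℝ≥0∞ :=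
  open scoped Classical in
  if μ Set.univ = 0 then f []
  else ∫⁻ x : Fin m → ι, f (List.ofFn x) ∂(Measure.pi (fun _ => (μ Set.univ)⁻¹ • μ))

/-- The semantics of a loop that is left after fewer than `n` rounds; runs that take longer
contribute zero. -/
def loopExp (b : State Q ι → Prop) (body : (State Q ι → ℝ≥0∞) → State Q ι → ℝ≥0∞)
    (f : State Q ι → ℝ≥0∞) : ℕ → State Q ι → ℝ≥0∞
  | 0, _ => 0
  | n + 1, s =>
      open scoped Classical in
      if b s then body (loopExp b body f n) (s.tick 1) else f (s.tick 1)

/-- `expect F w₀ O c f s` is the expected value of `f` in the final configuration of the program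
`c` started in `s`, where runs that do not halt contribute zero.  The answers of the oracles need
not depend measurably on their arguments; in this case the integrals are lower integrals, so
that `expect` never exceeds the true expectation.

Every elementary command, every test and every call of an oracle costs one step, and a call of
the dual subsystem oracle costs in addition one step for every family that it lists. -/
def expect [MeasurableSpace ι] (F : RangeSpace Q ι) (w₀ : Measure ι) (O : Oracles F) :
    Cmd → (State Q ι → ℝ≥0∞) → State Q ι → ℝ≥0∞
  | .setNat a e, f, s => f ((s.setNat (a.eval s) (e.eval s)).tick 1)
  | .setReal a e, f, s => f ((s.setReal (a.eval s) (e.eval s)).tick 1)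
  | .clear p, f, s => f ((s.setPts p []).tick 1)
  | .push p p' j, f, s => f ((s.setPts p (s.pts p ++ ((s.pts p')[j.eval s]?).toList)).tick 1)
  | .rand a n, f, s =>
      (∑ k ∈ Finset.range (n.eval s + 1), f ((s.setNat (a.eval s) k).tick 1))
        / ((n.eval s + 1 : ℕ) : ℝ≥0∞)
  | .sample r p base m, f, s =>
      drawExp (reweight F w₀ (s.pts p) (fun k => s.real (base.eval s + k))) (m.eval s)
        (fun L => f (((s.setRgs r L).addDraws (m.eval s)).tick 1))
  | .subsys g r, f, s =>
      f ((s.setFam g (O.subsys (s.rgs r))).tick (1 + (O.subsys (s.rgs r)).length))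
  | .pointIn p g k, f, s =>
      f ((s.setPts p (s.pts p ++
        (((s.fam g)[k.eval s]?).bind O.pointIn).toList)).tick 1)
  | .seq c₁ c₂, f, s => expect F w₀ O c₁ (expect F w₀ O c₂ f) s
  | .branch b c₁ c₂, f, s =>
      open scoped Classical in
      if b.eval F s then expect F w₀ O c₁ f (s.tick 1) else expect F w₀ O c₂ f (s.tick 1)
  | .loop b c, f, s => ⨆ n, loopExp (fun t => b.eval F t) (expect F w₀ O c) f n s

/-- The probability that the program halts in a configuration in `G`. -/
def prob [MeasurableSpace ι] (F : RangeSpace Q ι) (w₀ : Measure ι) (O : Oracles F)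
    (c : Cmd) (s : State Q ι) (G : Set (State Q ι)) : ℝ≥0∞ :=
  expect F w₀ O c (G.indicator 1) s

/-! ## The bounds -/

/-- The logarithm inside `O`-bounds, at least one. -/
def lg (x : ℝ) : ℝ := max 1 (Real.log x)

/-- The bound on the number of iterations (up to a constant factor). -/
def iterBound (d : ℕ) (ε δ : ℝ) (opt : ℕ) : ℝ :=
  d / (ε ^ 3 * (1 - ε)) * lg (d / ε) * opt * lg (opt / (ε * δ * (1 - ε)))

/-- The size of the random samples (up to a constant factor). -/
def sampleBound (d : ℕ) (ε : ℝ) (opt : ℕ) : ℝ :=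
  d * 2 ^ d * (opt : ℝ) ^ 2 / ε ^ 2 * lg (opt / ε)

end HittingSet

end

/-! The algorithm combines multiplicative weights with epsilon-nets and guesses `z = 2 ^ j` for the
fractional optimum, doubling the guess when a phase fails. A phase keeps a multiset `P` of points
and the weights `2 ^ (-|P ∩ R|)`. Each round draws ranges according to these weights and appends to
`P` a point that lies in many drawn ranges, if there is one.

One round works by symmetrization (`exists_good_samples`). The dual family has VC-dimension at most
`2 ^ (d + 1)`, so a sample of about `d 2 ^ d z ^ 2` ranges has, with probability `31 / 32`, two
properties: every point in a `1 / (2 z)` fraction of the sample carries true mass at least `1 / (16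
z)`, and a point of true mass `1 / z`, if there is one, forces some point above the threshold. If
`z` exceeds the fractional optimum, a point of mass `1 / z` exists for every distribution, by weak
duality (`exists_deep_point`).

A good point decreases the total weight by a factor `1 - 1 / (32 z)`. Hence the potential (total
weight times `(1 + 1 / (32 z)) ^ |P|`) does not increase in a good round and increases by a factor
of at most `1 + 1 / (32 z)` in a bad one. By Markov it is small at the end of the phase with high
probability. If then at least half of the `T = 256 z m` rounds have selected a point, where `m = l +
j + 8` and `2 ^ l ≥ 1 / δ`, the total weight is so small that the ranges hit at most `m` times by
`P` have measure at most `δ w₀(R)` (`light_le_of_potential_lt`). Every other range contains a `1 /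
(256 z)` fraction of `P`, so a uniform sample of `O(d z log(d z))` points of `P` hits all of them
(`measure_not_net_le`). This is the output.

A phase with fewer selections is rejected. For guesses that are too small both outcomes are
harmless: an accepted output is valid and even smaller. In the last phase `J`, where `2 ^ J ≤ 2 z*`,
a round selects nothing with probability at most `1 / 32`, so rejection has probability at most `1 /
16`. Phase `j` loses `2 ^ (-(j + 5))` for the potential and as much for the net; over all phases
this sums to at most `1 / 8`.

Oracle answers need not be measurable, so nothing is said about distributions of configurations.
Lower bounds for the success probability are propagated backwards through the program, and an
integral is bounded below through a measurable set of good samples. The supremum over all points in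
the symmetrization is treated by null measurability of projections of Borel sets. -/

namespace HittingSet

/-! ## Analytic sets are null measurable -/

/-- The capacity argument for Suslin sets. Bounding the coordinates of Baire space one at a time
loses arbitrarily little measure, since measures are continuous along increasing unions of arbitrary
sets. The sequences that obey all bounds form a compact set. -/
lemma exists_compact_subset_range {α : Type*} [TopologicalSpace α] [T2Space α]
    [MeasurableSpace α] [BorelSpace α] (μ : Measure α) [μ.OuterRegular]
    (f : (ℕ → ℕ) → α) (hf : Continuous f) (r : ℝ≥0∞) (hr : r < μ (Set.range f)) :
    ∃ K : Set α, IsCompact K ∧ K ⊆ Set.range f ∧ r ≤ μ K := by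
  have step : ∀ (k : ℕ) (B : Set (ℕ → ℕ)), r < μ (f '' B) →
      ∃ m : ℕ, r < μ (f '' (B ∩ {x | x k ≤ m})) := by
    intro k B hB
    have hU : f '' B = ⋃ m : ℕ, f '' (B ∩ {x | x k ≤ m}) := by
      rw [← Set.image_iUnion, ← Set.inter_iUnion]
      congr 1
      ext x
      simp only [Set.mem_inter_iff, Set.mem_iUnion, Set.mem_ofPred_eq]
      exact ⟨fun h => ⟨h, x k, le_rfl⟩, fun h => h.1⟩
    have hmono : Monotone fun m : ℕ => f '' (B ∩ {x : ℕ → ℕ | x k ≤ m}) := by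
      intro a b hab
      refine Set.image_mono (Set.inter_subset_inter_right _ ?_)
      intro x hx
      exact le_trans hx hab
    rw [hU, hmono.measure_iUnion] at hB
    exact lt_iSup_iff.1 hB
  choose m hm using step
  let B : ℕ → {B : Set (ℕ → ℕ) // r < μ (f '' B)} := fun k =>
    Nat.rec ⟨Set.univ, by rwa [Set.image_univ]⟩
      (fun k B => ⟨B.1 ∩ {x | x k ≤ m k B.1 B.2}, hm k B.1 B.2⟩) k
  let b : ℕ → ℕ := fun k => m k (B k).1 (B k).2
  have hBs : ∀ k, (B (k + 1)).1 = (B k).1 ∩ {x | x k ≤ b k} := fun k => rfl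
  have hB : ∀ k x, x ∈ (B k).1 → ∀ i < k, x i ≤ b i := by
    intro k
    induction k with
    | zero => intro x _ i hi; omega
    | succ k ih =>
      intro x hx i hi
      rw [hBs] at hx
      rcases Nat.lt_succ_iff_lt_or_eq.1 hi with h | h
      · exact ih x hx.1 i h
      · subst h; exact hx.2
  let K : Set (ℕ → ℕ) := Set.univ.pi fun i => Set.Iic (b i)
  have hK : IsCompact K := isCompact_univ_pi fun i => (Set.finite_Iic (b i)).isCompact
  refine ⟨f '' K, hK.image hf, Set.image_subset_range _ _, ?_⟩
  rw [Set.measure_eq_iInf_isOpen]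
  refine le_iInf₂ fun U hKU => le_iInf fun hU => ?_
  by_contra! hlt
  -- The images of the `B k` all exceed `r` in measure, so none fits into an open `U` of measure
  -- below `r`. A limit of the resulting points lies in `K` and contradicts `f '' K ⊆ U`.
  have hnot : ∀ k, ∃ x ∈ (B k).1, f x ∉ U := by
    intro k
    by_contra! h
    exact absurd ((B k).2.trans_le (measure_mono (Set.image_subset_iff.2 h))) (not_lt.2 hlt.le)
  choose x hxB hxU using hnot
  -- Only the first `k` coordinates of `x k` are controlled. Truncation moves the sequence into the
  -- compact set `K` without changing its coordinatewise limits.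
  let y : ℕ → ℕ → ℕ := fun k i => if i < k then x k i else 0
  have hy : ∀ k, y k ∈ K := by
    intro k i _
    by_cases h : i < k
    · simpa [y, h] using hB k (x k) (hxB k) i h
    · simp [y, h]
  obtain ⟨z, hz, φ, hφ, hlim⟩ := hK.tendsto_subseq hy
  have hlim' : Filter.Tendsto (x ∘ φ) Filter.atTop (nhds z) := by
    rw [tendsto_pi_nhds] at hlim ⊢
    intro i
    refine (hlim i).congr' ?_
    filter_upwards [Filter.eventually_gt_atTop i] with k hk
    have : i < φ k := hk.trans_le (hφ.id_le k)
    simp [y, this]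
  have hev := (hf.tendsto z).comp hlim'
  have hmem : ∀ᶠ k in Filter.atTop, f (x (φ k)) ∈ U :=
    hev (hU.mem_nhds (hKU (Set.mem_image_of_mem f hz)))
  obtain ⟨k, hk⟩ := hmem.exists
  exact hxU _ hk

/-- Countably many compact subsets exhaust the measure of the analytic set, so it agrees almost
everywhere with an F-sigma set. -/
theorem nullMeasurableSet_of_analyticSet {α : Type*} [TopologicalSpace α] [T2Space α]
    [MeasurableSpace α] [BorelSpace α] (μ : Measure α) [IsFiniteMeasure μ] [μ.OuterRegular]
    {A : Set α} (hA : AnalyticSet A) : NullMeasurableSet A μ := by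
  rw [AnalyticSet] at hA
  rcases hA with rfl | ⟨f, hf, rfl⟩
  · exact MeasurableSet.empty.nullMeasurableSet
  by_cases h0 : μ (Set.range f) = 0
  · exact NullMeasurableSet.of_null h0
  obtain ⟨r, -, hr, hlim⟩ := exists_seq_strictMono_tendsto' (pos_iff_ne_zero.2 h0)
  choose K hK hKA hKr using fun n =>
    exists_compact_subset_range μ f hf (r n) (hr n).2
  have hsub : (⋃ n, K n) ⊆ Set.range f := Set.iUnion_subset hKA
  have hmeas : MeasurableSet (⋃ n, K n) := MeasurableSet.iUnion fun n => (hK n).measurableSet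
  have hge : μ (Set.range f) ≤ μ (⋃ n, K n) :=
    le_of_tendsto' hlim fun n => (hKr n).trans (measure_mono (Set.subset_iUnion K n))
  exact hmeas.nullMeasurableSet.congr
    (ae_eq_of_subset_of_measure_ge hsub hge hmeas.nullMeasurableSet (measure_ne_top _ _))

/-- The projection of a measurable set along a standard Borel space is null measurable. -/
theorem nullMeasurableSet_exists {X Y : Type*} [MeasurableSpace X] [StandardBorelSpace X]
    [MeasurableSpace Y] [StandardBorelSpace Y] (μ : Measure Y) [IsFiniteMeasure μ]
    {s : Set (X × Y)} (hs : MeasurableSet s) : NullMeasurableSet {y | ∃ x, (x, y) ∈ s} μ := by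
  let := upgradeStandardBorel Y
  have h : {y | ∃ x, (x, y) ∈ s} = Prod.snd '' s := by
    ext y; simp
  rw [h]
  let := TopologicalSpace.upgradeIsCompletelyMetrizable Y
  exact nullMeasurableSet_of_analyticSet μ (hs.analyticSet_image measurable_snd)

/-! ## The number of traces of a family of bounded VC-dimension -/

lemma sum_choose_le (m D : ℕ) : ∑ k ∈ Finset.Iic D, m.choose k ≤ (m + 1) ^ D := by
  rw [add_pow]
  have : Finset.Iic D = Finset.range (D + 1) := by ext; simp
  rw [this]
  refine Finset.sum_le_sum fun k hk => ?_
  have hk' : k ≤ D := Nat.lt_succ_iff.1 (Finset.mem_range.1 hk)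
  calc m.choose k ≤ m ^ k := Nat.choose_le_pow m k
    _ ≤ m ^ k * 1 ^ (D - k) * D.choose k := by
        rw [one_pow, mul_one]
        exact Nat.le_mul_of_pos_right _ (Nat.choose_pos hk')

/-- No finite set of more than `D` points is shattered by the sets `S t`. -/
def NoShatter {X T : Type*} (S : T → Set X) (D : ℕ) : Prop :=
  ∀ B : Finset X, (∀ A ⊆ B, ∃ t, ∀ x ∈ B, x ∈ S t ↔ x ∈ A) → B.card ≤ D

/-- Sauer–Shelah for index sets. The points `z k` may repeat, but `z` is injective on every
shattered set of indices, so its image is a shattered set of the same size. -/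
lemma NoShatter.ncard_patterns_le {X T : Type*} {S : T → Set X} {D : ℕ} (h : NoShatter S D)
    {I : Type*} [Fintype I] (z : I → X) :
    (Set.range fun t => {k | z k ∈ S t}).ncard ≤ (Fintype.card I + 1) ^ D := by
  classical
  let pat : T → Finset I := fun t => Finset.univ.filter fun k => z k ∈ S t
  let 𝒜 : Finset (Finset I) := (Set.range pat).toFinset
  have hcard : (Set.range fun t => {k | z k ∈ S t}).ncard = 𝒜.card := by
    rw [← Set.ncard_eq_toFinset_card']
    have : (Set.range fun t => {k | z k ∈ S t}) = (fun s : Finset I => (s : Set I)) '' Set.range pat := by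
      rw [← Set.range_comp]
      congr 1
      funext t
      ext k
      simp [pat]
    rw [this, Set.ncard_image_of_injective _ Finset.coe_injective]
  have hvc : 𝒜.vcDim ≤ D := by
    refine Finset.sup_le fun B hB => ?_
    rw [Finset.mem_shatterer] at hB
    have key : ∀ A ⊆ B, ∃ t, ∀ k ∈ B, z k ∈ S t ↔ k ∈ A := by
      intro A hA
      obtain ⟨U, hU, hBU⟩ := hB hA
      obtain ⟨t, rfl⟩ := Set.mem_toFinset.1 hU
      refine ⟨t, fun k hk => ?_⟩
      rw [← hBU]
      simp [pat, hk]
    have hinj : Set.InjOn z B := by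
      intro a ha b hb hab
      by_contra hne
      obtain ⟨t, ht⟩ := key {a} (by simpa using ha)
      have h1 := (ht a ha).2 (by simp)
      have h2 := (ht b hb).1 (hab ▸ h1)
      exact hne (Finset.mem_singleton.1 h2).symm
    rw [← Finset.card_image_of_injOn hinj]
    refine h _ fun A hA => ?_
    obtain ⟨t, ht⟩ := key (B.filter fun k => z k ∈ A) (Finset.filter_subset _ _)
    refine ⟨t, fun x hx => ?_⟩
    obtain ⟨k, hk, rfl⟩ := Finset.mem_image.1 hx
    rw [ht k hk]
    simp [hk]
  rw [hcard]
  calc 𝒜.card ≤ 𝒜.shatterer.card := Finset.card_le_card_shatterer _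
    _ ≤ ∑ k ∈ Finset.Iic 𝒜.vcDim, (Fintype.card I).choose k := Finset.card_shatterer_le_sum_vcDim
    _ ≤ ∑ k ∈ Finset.Iic D, (Fintype.card I).choose k :=
        Finset.sum_le_sum_of_subset (Finset.Iic_subset_Iic.2 hvc)
    _ ≤ _ := sum_choose_le _ _

namespace RangeSpace

variable {Q : Type u} {ι : Type v}

lemma noShatter_range {F : RangeSpace Q ι} {d : ℕ} (h : F.vcDim ≤ d) : NoShatter F.range d := by
  intro B hB
  classical
  have hs : F.Shatters B := by
    intro A hA
    obtain ⟨i, hi⟩ := hB (B.filter fun x => x ∈ A) (Finset.filter_subset _ _)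
    refine ⟨i, ?_⟩
    ext x
    constructor
    · intro hx
      exact ⟨(hi x (hA hx)).2 (by simpa [hx] using hA hx), hA hx⟩
    · rintro ⟨hx, hxB⟩
      exact (Finset.mem_filter.1 ((hi x hxB).1 hx)).2
  have : (B.card : ℕ∞) ≤ d := le_trans (le_iSup₂_of_le B hs le_rfl) h
  exact_mod_cast this

/-- If more than `2 ^ (d + 1)` ranges were dually shattered, some of them could be labelled by the
subsets of a `(d + 1)`-element set, and points `q a` would exist that lie in exactly the ranges
whose label contains `a`. These `d + 1` points would be shattered by the labelled ranges. -/
lemma noShatter_dual {F : RangeSpace Q ι} {d : ℕ} (h : F.vcDim ≤ d) :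
    NoShatter F.dual.range (2 ^ (d + 1)) := by
  classical
  intro B hB
  by_contra! hlt
  obtain ⟨e⟩ : Nonempty (Finset (Fin (d + 1)) ↪ B) :=
    Function.Embedding.nonempty_of_card_le (by simpa using hlt.le)
  have hq : ∀ a : Fin (d + 1), ∃ q, ∀ A : Finset (Fin (d + 1)), q ∈ F.range (e A) ↔ a ∈ A := by
    intro a
    obtain ⟨q, hq⟩ := hB (B.filter fun i => ∃ A, (e A : ι) = i ∧ a ∈ A) (Finset.filter_subset _ _)
    refine ⟨q, fun A => ?_⟩
    have := hq (e A) (e A).2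
    rw [show q ∈ F.range (e A) ↔ (e A : ι) ∈ F.dual.range q from Iff.rfl, this]
    simp only [Finset.mem_filter, (e A).2, true_and]
    constructor
    · rintro ⟨A', h1, h2⟩
      rwa [← e.injective (Subtype.ext h1)]
    · exact fun h => ⟨A, rfl, h⟩
  choose q hq using hq
  have hinj : Function.Injective q := by
    intro a b hab
    have := (hq b {a}).1 (hab ▸ (hq a {a}).2 (by simp))
    exact (Finset.mem_singleton.1 this).symm
  have := noShatter_range h (Finset.univ.image q) fun A hA => by
    refine ⟨e (Finset.univ.filter fun a => q a ∈ A), fun x hx => ?_⟩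
    obtain ⟨a, -, rfl⟩ := Finset.mem_image.1 hx
    rw [hq]
    simp
  rw [Finset.card_image_of_injective _ hinj] at this
  simp at this

end RangeSpace

/-! ## Symmetrization -/

section Symmetrization

variable {X T I : Type*}

open scoped Classical in
/-- The weight `u ^ #x * v ^ #y` of a subset of a double sample, where `#x` and `#y` count its
elements in the two halves. -/
noncomputable def pairWeight [Fintype I] (u v : ℝ≥0∞) (A : Set (I ⊕ I)) : ℝ≥0∞ :=
  ∏ i, (if Sum.inl i ∈ A then u else 1) * (if Sum.inr i ∈ A then v else 1)

/-- Exchange the two copies of those `i` with `σ i = true`. -/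
def swapPerm (σ : I → Bool) : Equiv.Perm (I ⊕ I) where
  toFun := Sum.elim (fun i => if σ i then .inr i else .inl i) fun i => if σ i then .inl i else .inr i
  invFun := Sum.elim (fun i => if σ i then .inr i else .inl i) fun i => if σ i then .inl i else .inr i
  left_inv := by rintro (i | i) <;> cases h : σ i <;> simp [h]
  right_inv := by rintro (i | i) <;> cases h : σ i <;> simp [h]

/-- The average over independent swaps factors over the pairs. A pair contributes `u * v`, `(u + v)
/ 2` or `1`, according to whether both, one or none of its members lie in `A`, so each factor is at
most one. -/
lemma sum_pairWeight_le [Fintype I] [DecidableEq I] {u v : ℝ≥0∞} (huv : u + v ≤ 2) (huv' : u * v ≤ 1)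
    (A : Set (I ⊕ I)) :
    ∑ σ : I → Bool, pairWeight u v (swapPerm σ ⁻¹' A) ≤ 2 ^ Fintype.card I := by
  classical
  let g : I → Bool → ℝ≥0∞ := fun i b =>
    (if (if b then Sum.inr i else Sum.inl i : I ⊕ I) ∈ A then u else 1) *
      (if (if b then Sum.inl i else Sum.inr i : I ⊕ I) ∈ A then v else 1)
  have h1 : ∀ σ : I → Bool, pairWeight u v (swapPerm σ ⁻¹' A) = ∏ i, g i (σ i) := fun σ => rfl
  simp_rw [h1]
  rw [← Fintype.prod_sum, ← Finset.card_univ, ← Finset.prod_const]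
  refine Finset.prod_le_prod' fun i _ => ?_
  have h2 : (1 : ℝ≥0∞) + 1 = 2 := one_add_one_eq_two
  rw [Fintype.sum_bool]
  by_cases ha : Sum.inl i ∈ A <;> by_cases hb : Sum.inr i ∈ A <;> simp [g, ha, hb]
  · rw [← h2]; exact add_le_add huv' huv'
  · rw [add_comm]; exact huv
  · exact huv
  · rw [h2]

/-- Markov's inequality for each pattern and a union bound over the patterns. -/
lemma card_swap_le [Fintype I] [DecidableEq I] {u v c : ℝ≥0∞} (huv : u + v ≤ 2) (huv' : u * v ≤ 1)
    (hc0 : c ≠ 0) (hc : c ≠ ∞) (𝒜 : Set (Set (I ⊕ I))) :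
    (∑ σ : I → Bool, {σ : I → Bool | ∃ A ∈ 𝒜, c ≤ pairWeight u v (swapPerm σ ⁻¹' A)}.indicator
      (1 : (I → Bool) → ℝ≥0∞) σ) ≤ 2 ^ Fintype.card I * (𝒜.ncard / c) := by
  classical
  have hfin : 𝒜.Finite := Set.toFinite _
  calc _ ≤ ∑ σ : I → Bool, ∑ A ∈ hfin.toFinset, pairWeight u v (swapPerm σ ⁻¹' A) / c := by
        refine Finset.sum_le_sum fun σ _ => ?_
        rw [Set.indicator_apply]
        split_ifs with h
        swap
        · exact bot_le
        obtain ⟨A, hA, hcA⟩ := h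
        calc (1 : ℝ≥0∞) = c / c := (ENNReal.div_self hc0 hc).symm
          _ ≤ pairWeight u v (swapPerm σ ⁻¹' A) / c := by gcongr
          _ ≤ _ := Finset.single_le_sum
              (f := fun A => pairWeight u v (swapPerm σ ⁻¹' A) / c)
              (fun _ _ => bot_le) (hfin.mem_toFinset.2 hA)
    _ = ∑ A ∈ hfin.toFinset, (∑ σ : I → Bool, pairWeight u v (swapPerm σ ⁻¹' A)) / c := by
        rw [Finset.sum_comm]
        simp_rw [ENNReal.div_eq_inv_mul, Finset.mul_sum]
    _ ≤ ∑ A ∈ hfin.toFinset, 2 ^ Fintype.card I / c := by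
        refine Finset.sum_le_sum fun A _ => ?_
        gcongr
        exact sum_pairWeight_le huv huv' A
    _ = _ := by
        rw [Finset.sum_const, nsmul_eq_mul, Set.ncard_eq_toFinset_card _ hfin]
        simp only [ENNReal.div_eq_inv_mul]
        ring

variable [MeasurableSpace X]

/-- The double samples on which some set of the family has large weight. -/
def heavyPairs [Fintype I] (S : T → Set X) (u v c : ℝ≥0∞) : Set (I ⊕ I → X) :=
  {z | ∃ t, c ≤ pairWeight u v {k | z k ∈ S t}}

/-- Swaps preserve the product measure, so the measure of the event is its average over all swaps;
for a fixed double sample only finitely many patterns matter. -/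
lemma measure_heavyPairs_le [Fintype I] [DecidableEq I] (ν : Measure X) [IsProbabilityMeasure ν]
    (S : T → Set X) {u v c : ℝ≥0∞} (huv : u + v ≤ 2) (huv' : u * v ≤ 1)
    (hc0 : c ≠ 0) (hc : c ≠ ∞) (G : ℕ)
    (hG : ∀ z : I ⊕ I → X, (Set.range fun t => {k | z k ∈ S t}).ncard ≤ G)
    (hD : NullMeasurableSet (heavyPairs (I := I) S u v c) (Measure.pi fun _ : I ⊕ I => ν)) :
    (Measure.pi fun _ : I ⊕ I => ν) (heavyPairs S u v c) ≤ G / c := by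
  classical
  set M := Measure.pi fun _ : I ⊕ I => ν
  set D : Set (I ⊕ I → X) := heavyPairs S u v c
  have hmp : ∀ σ : I → Bool, MeasurePreserving (fun z : I ⊕ I → X => z ∘ swapPerm σ) M M := by
    intro σ
    exact measurePreserving_arrowCongr' (fun _ : I ⊕ I => ν) (fun _ => ν) (swapPerm σ).symm
      (MeasurableEquiv.refl X) fun _ => MeasurePreserving.id ν
  have hsum : (2 : ℝ≥0∞) ^ Fintype.card I * M D ≤ 2 ^ Fintype.card I * (G / c) := by
    calc (2 : ℝ≥0∞) ^ Fintype.card I * M D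
        = ∑ σ : I → Bool, M ((fun z : I ⊕ I → X => z ∘ swapPerm σ) ⁻¹' D) := by
          simp_rw [fun σ => (hmp σ).measure_preimage hD]
          simp
      _ = ∫⁻ z, ∑ σ : I → Bool, ((fun z : I ⊕ I → X => z ∘ swapPerm σ) ⁻¹' D).indicator 1 z ∂M := by
          rw [lintegral_finsetSum']
          · refine Finset.sum_congr rfl fun σ _ => ?_
            rw [lintegral_indicator_one₀ (hD.preimage (hmp σ).quasiMeasurePreserving)]
          · intro σ _
            exact aemeasurable_const.indicator₀ (hD.preimage (hmp σ).quasiMeasurePreserving)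
      _ ≤ ∫⁻ z, 2 ^ Fintype.card I * (G / c) ∂M := by
          refine lintegral_mono fun z => ?_
          refine le_trans (le_of_eq ?_) ((card_swap_le huv huv' hc0 hc
            (Set.range fun t => {k | z k ∈ S t})).trans ?_)
          · refine Finset.sum_congr rfl fun σ _ => ?_
            simp only [Set.indicator_apply]
            congr 1
            simp [D, heavyPairs]
          · gcongr
            exact hG z
      _ = _ := by simp [M]
  exact (ENNReal.mul_le_mul_iff_right (by simp) (by simp)).1 hsum

/-- If, for every bad sample `x`, with probability at least `1/2` a ghost sample `y` turns it into
a heavy double sample, then the outer measure of the bad samples is small. -/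
theorem measure_bad_le [Fintype I] [DecidableEq I] (ν : Measure X) [IsProbabilityMeasure ν]
    (S : T → Set X) {u v c : ℝ≥0∞} (huv : u + v ≤ 2) (huv' : u * v ≤ 1)
    (hc0 : c ≠ 0) (hc : c ≠ ∞) (G : ℕ)
    (hG : ∀ z : I ⊕ I → X, (Set.range fun t => {k | z k ∈ S t}).ncard ≤ G)
    (hD : NullMeasurableSet (heavyPairs (I := I) S u v c) (Measure.pi fun _ : I ⊕ I => ν))
    (bad : Set (I → X))
    (hbad : ∀ x ∈ bad, ∃ t, 2⁻¹ ≤ (Measure.pi fun _ : I => ν)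
      {y | c ≤ pairWeight u v {k | Sum.elim x y k ∈ S t}}) :
    (Measure.pi fun _ : I => ν) bad ≤ 2 * (G / c) := by
  classical
  set M := Measure.pi fun _ : I ⊕ I => ν
  set D : Set (I ⊕ I → X) := heavyPairs S u v c
  -- Sections of a null measurable set are awkward. A measurable hull of the same measure allows
  -- Fubini, and Markov's inequality for its section measures covers `bad` without any measurability
  -- of `bad`.
  set D' := toMeasurable M D
  have hD' : MeasurableSet D' := measurableSet_toMeasurable _ _
  have hmp := (measurePreserving_sumPiEquivProdPi_symm fun _ : I ⊕ I => ν)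
  set e := (MeasurableEquiv.sumPiEquivProdPi fun _ : I ⊕ I => X)
  have hmeas : MeasurableSet (e.symm ⁻¹' D') := e.symm.measurable hD'
  have hM : M D' = ∫⁻ x, (Measure.pi fun _ : I => ν) (Prod.mk x ⁻¹' (e.symm ⁻¹' D'))
      ∂(Measure.pi fun _ : I => ν) := by
    rw [← hmp.measure_preimage hD'.nullMeasurableSet, Measure.prod_apply hmeas]
  have hsub : bad ⊆ {x | 2⁻¹ ≤ (Measure.pi fun _ : I => ν) (Prod.mk x ⁻¹' (e.symm ⁻¹' D'))} := by
    intro x hx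
    obtain ⟨t, ht⟩ := hbad x hx
    refine ht.trans (measure_mono fun y hy => ?_)
    refine subset_toMeasurable M D ⟨t, ?_⟩
    refine le_trans hy (le_of_eq ?_)
    congr 1
  calc (Measure.pi fun _ : I => ν) bad ≤ _ := measure_mono hsub
    _ ≤ (∫⁻ x, (Measure.pi fun _ : I => ν) (Prod.mk x ⁻¹' (e.symm ⁻¹' D'))
      ∂(Measure.pi fun _ : I => ν)) / 2⁻¹ :=
        meas_ge_le_lintegral_div (measurable_measure_prodMk_left hmeas).aemeasurable
          (by simp) (by simp)
    _ = 2 * M D := by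
        rw [← hM, measure_toMeasurable, ENNReal.div_eq_inv_mul, inv_inv]
    _ ≤ _ := by
        gcongr
        exact measure_heavyPairs_le ν S huv huv' hc0 hc G hG hD

end Symmetrization

/-! ## Counting hits in a random sample -/

open scoped Classical in
/-- The number of sample points that lie in `S`. -/
noncomputable def sampleCount {X I : Type*} [Fintype I] (x : I → X) (S : Set X) : ℕ :=
  (Finset.univ.filter fun k => x k ∈ S).card

section SampleCount

variable {X I : Type*} [Fintype I]

lemma pairWeight_elim (u v : ℝ≥0∞) (x y : I → X) (S : Set X) :
    pairWeight u v {k | Sum.elim x y k ∈ S} = u ^ sampleCount x S * v ^ sampleCount y S := by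
  classical
  unfold pairWeight sampleCount
  rw [Finset.prod_mul_distrib, ← Finset.prod_filter, ← Finset.prod_filter, Finset.prod_const,
    Finset.prod_const]
  simp
  congr!

lemma sampleCount_eq_sum (x : I → X) (S : Set X) :
    (sampleCount x S : ℝ≥0∞) = ∑ k, S.indicator 1 (x k) := by
  classical
  unfold sampleCount
  simp [Set.indicator_apply]

lemma pow_sampleCount (a : ℝ) (x : I → X) (S : Set X) [DecidablePred (· ∈ S)] :
    a ^ sampleCount x S = ∏ k, if x k ∈ S then a else 1 := by
  classical
  unfold sampleCount
  rw [← Finset.prod_filter, Finset.prod_const]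
  congr!

variable [MeasurableSpace X] (ν : Measure X) [IsProbabilityMeasure ν]

lemma measurable_sampleCount {S : Set X} (hS : MeasurableSet S) :
    Measurable fun x : I → X => sampleCount x S := by
  classical
  unfold sampleCount
  simp_rw [Finset.card_filter]
  refine Finset.measurable_sum _ fun k _ => ?_
  exact Measurable.ite (measurable_pi_apply k hS) measurable_const measurable_const

lemma lintegral_sampleCount {S : Set X} (hS : MeasurableSet S) :
    ∫⁻ x : I → X, (sampleCount x S : ℝ≥0∞) ∂(Measure.pi fun _ => ν) = Fintype.card I * ν S := by
  simp_rw [sampleCount_eq_sum]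
  have hm : Measurable (S.indicator (1 : X → ℝ≥0∞)) := measurable_one.indicator hS
  rw [lintegral_finsetSum (f := fun k (x : I → X) => S.indicator 1 (x k)) _
    fun k _ => hm.comp (measurable_pi_apply k)]
  have : ∀ k, ∫⁻ x : I → X, S.indicator 1 (x k) ∂(Measure.pi fun _ => ν) = ν S := by
    intro k
    rw [(measurePreserving_eval (fun _ : I => ν) k).lintegral_comp hm, lintegral_indicator_one hS]
  simp [this]

/-- Markov's inequality: the expected count is at most `m / 2`. -/
lemma half_le_measure_sampleCount_le {S : Set X} (hS : MeasurableSet S) {m : ℕ} (hm : 0 < m)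
    (h : 2 * (Fintype.card I * ν.real S) ≤ m) :
    2⁻¹ ≤ (Measure.pi fun _ : I => ν) {x | sampleCount x S ≤ m} := by
  set M := (Measure.pi fun _ : I => ν)
  have hmeas : MeasurableSet {x : I → X | sampleCount x S ≤ m} :=
    measurable_sampleCount hS measurableSet_Iic
  have h1 : M {x : I → X | sampleCount x S ≤ m}ᶜ ≤ 2⁻¹ := by
    calc M {x : I → X | sampleCount x S ≤ m}ᶜ
        ≤ M {x | (m : ℝ≥0∞) ≤ (sampleCount x S : ℝ≥0∞)} := by
          refine measure_mono fun x hx => ?_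
          have : ¬ sampleCount x S ≤ m := hx
          have : m ≤ sampleCount x S := by omega
          exact_mod_cast this
      _ ≤ (∫⁻ x : I → X, (sampleCount x S : ℝ≥0∞) ∂M) / m :=
          meas_ge_le_lintegral_div
            (measurable_from_top.comp (measurable_sampleCount hS)).aemeasurable
            (by exact_mod_cast hm.ne') (by simp)
      _ ≤ 2⁻¹ := by
          rw [lintegral_sampleCount ν hS, ENNReal.div_le_iff (by exact_mod_cast hm.ne') (by simp),
            ← ofReal_measureReal (μ := ν) (s := S)]
          have h2 : (2⁻¹ : ℝ≥0∞) = ENNReal.ofReal (2⁻¹) := by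
            rw [ENNReal.ofReal_inv_of_pos two_pos]; simp
          rw [h2, ← ENNReal.ofReal_natCast, ← ENNReal.ofReal_natCast m,
            ← ENNReal.ofReal_mul (by positivity), ← ENNReal.ofReal_mul (by positivity)]
          exact ENNReal.ofReal_le_ofReal (by linarith)
  rw [prob_compl_eq_one_sub hmeas] at h1
  have h3 := ENNReal.one_sub_inv_two
  have : (1 : ℝ≥0∞) ≤ 2⁻¹ + M {x : I → X | sampleCount x S ≤ m} := tsub_le_iff_right.1 h1
  rw [← ENNReal.inv_two_add_inv_two] at this
  exact (ENNReal.add_le_add_iff_left (by simp)).1 this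

/-- Exponential Markov inequality for `(1 / 2) ^ count`: its mean is at most `exp (-k)`, so the
probability is at most `(2 / e) ^ k ≤ (3 / 4) ^ k`. -/
lemma measure_sampleCount_lt_le {S : Set X} (hS : MeasurableSet S) {k : ℕ} (hk : 32 ≤ k)
    (h : 2 * k ≤ Fintype.card I * ν.real S) :
    (Measure.pi fun _ : I => ν).real {x | sampleCount x S < k} ≤ 1 / 64 := by
  classical
  set M := (Measure.pi fun _ : I => ν)
  have hint : ∫ x : I → X, (1 / 2 : ℝ) ^ sampleCount x S ∂M = (1 - ν.real S / 2) ^ Fintype.card I := by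
    simp_rw [pow_sampleCount]
    rw [integral_fintype_prod_eq_pow (fun a : X => if a ∈ S then (1 / 2 : ℝ) else 1)]
    congr 1
    have : (fun a : X => if a ∈ S then (1 / 2 : ℝ) else 1)
        = fun a => 1 - S.indicator (fun _ => (1 / 2 : ℝ)) a := by
      funext a
      by_cases ha : a ∈ S <;> simp [ha]
      norm_num
    rw [this, integral_sub (integrable_const _) ((integrable_const _).indicator hS),
      integral_indicator_const _ hS]
    simp
    ring
  have hmeas : Measurable fun x : I → X => (1 / 2 : ℝ) ^ sampleCount x S :=
    measurable_from_top.comp (measurable_sampleCount hS)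
  have hinteg : Integrable (fun x : I → X => (1 / 2 : ℝ) ^ sampleCount x S) M := by
    refine Integrable.of_bound hmeas.aestronglyMeasurable 1 (Filter.Eventually.of_forall fun x => ?_)
    rw [Real.norm_of_nonneg (by positivity)]
    exact pow_le_one₀ (by norm_num) (by norm_num)
  have hmarkov := mul_meas_ge_le_integral_of_nonneg (μ := M)
    (Filter.Eventually.of_forall fun x => by positivity) hinteg ((1 / 2 : ℝ) ^ k)
  have hp1 : ν.real S ≤ 1 := measureReal_le_one
  have hp0 : 0 ≤ ν.real S := measureReal_nonneg
  have hexp : (1 - ν.real S / 2) ^ Fintype.card I ≤ Real.exp (-1) ^ k := by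
    calc (1 - ν.real S / 2) ^ Fintype.card I ≤ Real.exp (-(ν.real S / 2)) ^ Fintype.card I := by
          gcongr
          · linarith
          · exact Real.one_sub_le_exp_neg _
      _ = Real.exp (-(Fintype.card I * ν.real S / 2)) := by
          rw [← Real.exp_nat_mul]; ring_nf
      _ ≤ Real.exp (-k) := Real.exp_le_exp.2 (by linarith)
      _ = Real.exp (-1) ^ k := by rw [← Real.exp_nat_mul]; ring_nf
  have hexp1 : Real.exp (-1) ≤ 3 / 8 := by
    rw [Real.exp_neg, inv_le_comm₀ (Real.exp_pos _) (by norm_num)]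
    have := Real.exp_one_gt_d9
    norm_num at this ⊢
    linarith
  have hle : M.real {x : I → X | sampleCount x S < k}
      ≤ M.real {x : I → X | (1 / 2 : ℝ) ^ k ≤ (1 / 2 : ℝ) ^ sampleCount x S} := by
    refine measureReal_mono fun x hx => ?_
    exact pow_le_pow_of_le_one (a := (1 / 2 : ℝ)) (by norm_num) (by norm_num) (le_of_lt hx)
  have hpow : (3 / 8 : ℝ) ^ k = (3 / 4) ^ k * (1 / 2) ^ k := by rw [← mul_pow]; norm_num
  have h34 : (3 / 4 : ℝ) ^ k ≤ 1 / 64 :=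
    (pow_le_pow_of_le_one (by norm_num) (by norm_num) hk).trans (by norm_num)
  have hk0 : (0 : ℝ) < (1 / 2) ^ k := by positivity
  have : (1 / 2 : ℝ) ^ k * M.real {x : I → X | (1 / 2 : ℝ) ^ k ≤ (1 / 2 : ℝ) ^ sampleCount x S}
      ≤ (1 / 2 : ℝ) ^ k * (1 / 64) := by
    calc _ ≤ Real.exp (-1) ^ k := (hmarkov.trans hint.le).trans hexp
      _ ≤ (3 / 8) ^ k := by gcongr
      _ ≤ _ := by rw [hpow, mul_comm]; gcongr
  exact hle.trans (le_of_mul_le_mul_left this hk0)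

end SampleCount

lemma two_mul_natCast_div_le {a e m : ℕ} {c : ℝ≥0∞} (h : 2 * a * 2 ^ e ≤ 2 ^ m)
    (hc : (2 : ℝ≥0∞) ^ m ≤ c) (hc' : c ≠ ∞) : 2 * ((a : ℝ≥0∞) / c) ≤ (2 ^ e)⁻¹ := by
  have hc0 : (c : ℝ≥0∞) ≠ 0 := ((ENNReal.pow_pos (by simp) m).trans_le hc).ne'
  rw [ENNReal.le_inv_iff_mul_le, ← mul_div_assoc, mul_comm, ← mul_div_assoc,
    ENNReal.div_le_iff hc0 hc', one_mul]
  refine le_trans ?_ hc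
  rw [mul_comm]
  exact_mod_cast h

/-! ## Random samples of ranges -/

namespace RangeSpace

variable {Q : Type u} {ι : Type v} [MeasurableSpace Q] [MeasurableSpace ι]

lemma MeasurableIncidence.measurableSet_dual {F : RangeSpace Q ι} (hF : F.MeasurableIncidence)
    (q : Q) : MeasurableSet (F.dual.range q) := measurable_prodMk_left hF

/-- The event is a union over all points of `Q`, possibly uncountable; it is the projection along
`Q` of a Borel set. -/
lemma nullMeasurableSet_heavyPairs_dual [StandardBorelSpace Q] [StandardBorelSpace ι]
    {F : RangeSpace Q ι} (hF : F.MeasurableIncidence) {I : Type*} [Fintype I]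
    (M : Measure (I ⊕ I → ι)) [IsFiniteMeasure M] (u v c : ℝ≥0∞) :
    NullMeasurableSet (heavyPairs F.dual.range u v c) M := by
  classical
  refine nullMeasurableSet_exists (X := Q) M
    (s := {p | c ≤ pairWeight u v {k | p.2 k ∈ F.dual.range p.1}}) ?_
  have hk : ∀ k : I ⊕ I, MeasurableSet {p : Q × (I ⊕ I → ι) | p.2 k ∈ F.dual.range p.1} := fun k =>
    hF.preimage (measurable_fst.prodMk ((measurable_pi_apply k).comp measurable_snd))
  refine measurableSet_le measurable_const ?_
  unfold pairWeight
  refine Finset.measurable_prod _ fun i _ => Measurable.mul ?_ ?_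
  · exact Measurable.ite (hk (Sum.inl i)) measurable_const measurable_const
  · exact Measurable.ite (hk (Sum.inr i)) measurable_const measurable_const

end RangeSpace

/-- The number of sampled ranges for the guess `2 ^ j` of the fractional optimum. -/
def sampleSize (d j : ℕ) : ℕ := 512 * d * 2 ^ d * (2 ^ j) ^ 2

/-- The number of sampled ranges that a point has to hit in order to be selected. -/
def heavyCount (d j : ℕ) : ℕ := 256 * d * 2 ^ d * 2 ^ j

lemma sampleSize_arith {d : ℕ} (hd : 1 ≤ d) (j : ℕ) :
    2 * (sampleSize d j + sampleSize d j + 1) ^ 2 ^ (d + 1) * 2 ^ 6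
      ≤ 2 ^ (64 * d * 2 ^ d * 2 ^ j) := by
  have hj : j + 1 ≤ 2 ^ j := Nat.lt_two_pow_self
  have hdd : d < 2 ^ d := Nat.lt_two_pow_self
  have h1 : sampleSize d j + sampleSize d j + 1 ≤ 2 ^ (11 + 2 * d + 2 * j) := by
    have e : (2 : ℕ) ^ (11 + 2 * d + 2 * j) = 2048 * 2 ^ d * 2 ^ d * (2 ^ j) ^ 2 := by
      rw [pow_add, pow_add, ← pow_mul]; ring
    rw [e]
    have h2 : 1 ≤ d * 2 ^ d * (2 ^ j) ^ 2 := by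
      have : 0 < d * 2 ^ d * (2 ^ j) ^ 2 := by positivity
      omega
    have h3 : d * 2 ^ d * (2 ^ j) ^ 2 ≤ 2 ^ d * 2 ^ d * (2 ^ j) ^ 2 := by gcongr
    unfold sampleSize
    nlinarith
  calc 2 * (sampleSize d j + sampleSize d j + 1) ^ 2 ^ (d + 1) * 2 ^ 6
      ≤ 2 * (2 ^ (11 + 2 * d + 2 * j)) ^ 2 ^ (d + 1) * 2 ^ 6 := by gcongr
    _ = 2 ^ (7 + (11 + 2 * d + 2 * j) * 2 ^ (d + 1)) := by
        rw [← pow_mul, pow_add]; ring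
    _ ≤ _ := by
        refine Nat.pow_le_pow_right (by norm_num) ?_
        have h4 : 26 + 4 * d + 4 * j ≤ 64 * (d * 2 ^ j) := by
          have : j + 1 ≤ d * 2 ^ j := hj.trans (Nat.le_mul_of_pos_left _ hd)
          have : d ≤ d * 2 ^ j := Nat.le_mul_of_pos_right _ (by positivity)
          omega
        have h5 : 1 ≤ 2 ^ d := Nat.one_le_two_pow
        calc 7 + (11 + 2 * d + 2 * j) * 2 ^ (d + 1) ≤ (26 + 4 * d + 4 * j) * 2 ^ d := by
              rw [pow_succ]; nlinarith
          _ ≤ 64 * (d * 2 ^ j) * 2 ^ d := by gcongr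
          _ = _ := by ring

/-- With probability at least `31 / 32`, the points that hit many of the sampled ranges hit many
ranges. -/
theorem exists_good_samples {Q : Type u} {ι : Type v} [MeasurableSpace Q] [StandardBorelSpace Q]
    [MeasurableSpace ι] [StandardBorelSpace ι] {F : RangeSpace Q ι} (hF : F.MeasurableIncidence)
    {d : ℕ} (hd : 1 ≤ d) (hvc : F.vcDim ≤ d) (ν : Measure ι) [IsProbabilityMeasure ν] (j : ℕ) :
    ∃ G : Set (Fin (sampleSize d j) → ι), MeasurableSet G ∧
      31 / 32 ≤ (Measure.pi fun _ => ν).real G ∧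
      (∀ x ∈ G, ∀ q, heavyCount d j ≤ sampleCount x (F.dual.range q) →
        1 ≤ 16 * 2 ^ j * ν.real (F.dual.range q)) ∧
      ((∃ q, 1 ≤ 2 ^ j * ν.real (F.dual.range q)) →
        ∀ x ∈ G, ∃ q, heavyCount d j ≤ sampleCount x (F.dual.range q)) := by
  classical
  set M := Measure.pi fun _ : Fin (sampleSize d j) => ν
  have hS := hF.measurableSet_dual
  have hz : 1 ≤ 2 ^ j := Nat.one_le_two_pow
  have hz' : (0 : ℝ) < 2 ^ j := by positivity
  -- The unit of the argument: the threshold is `4 m` and the sample size is `8 m 2 ^ j`. A point of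
  -- mass below `1 / (16 * 2 ^ j)` has expected count at most `m / 2`; one of mass at least `2 ^
  -- (-j)` has expected count at least `8 m`.
  let m := 64 * d * 2 ^ d * 2 ^ j
  have hm0 : 64 ≤ m := by
    have : 0 < d * 2 ^ d * 2 ^ j := by positivity
    simp only [m]; nlinarith
  have hh : heavyCount d j = 4 * m := by simp only [heavyCount, m]; ring
  have hN : (sampleSize d j : ℝ) = 8 * m * 2 ^ j := by
    simp only [sampleSize, m]; push_cast; ring
  let bad : Set (Fin (sampleSize d j) → ι) := {x | ∃ q, heavyCount d j ≤ sampleCount x (F.dual.range q) ∧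
      16 * 2 ^ j * ν.real (F.dual.range q) < 1}
  -- With these weights `4 m` hits in the sample and at most `m` hits in the ghost sample give
  -- weight at least `(81 / 32) ^ m ≥ 2 ^ m`, which beats the number of dual patterns.
  let u : NNReal := 3 / 2
  let v : NNReal := 1 / 2
  let c : ℝ≥0∞ := (u : ℝ≥0∞) ^ (4 * m) * (v : ℝ≥0∞) ^ m
  have hc : (2 : ℝ≥0∞) ^ m ≤ c := by
    simp only [c, pow_mul, ← mul_pow]
    gcongr
    have : (2 : NNReal) ≤ u ^ 4 * v := by simp only [u, v]; rw [← NNReal.coe_le_coe]; push_cast; norm_num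
    exact_mod_cast this
  have hc' : c ≠ ∞ := ENNReal.mul_ne_top (by simp) (by simp)
  have hbad : M bad ≤ (2 ^ 6)⁻¹ := by
    refine (measure_bad_le ν F.dual.range (u := u) (v := v) (c := c) ?_ ?_ ?_ hc'
      ((sampleSize d j + sampleSize d j + 1) ^ 2 ^ (d + 1)) ?_
      (RangeSpace.nullMeasurableSet_heavyPairs_dual hF _ _ _ _) bad ?_).trans
      (two_mul_natCast_div_le (sampleSize_arith hd j) hc hc')
    · have : u + v ≤ 2 := by simp only [u, v]; rw [← NNReal.coe_le_coe]; push_cast; norm_num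
      exact_mod_cast this
    · have : u * v ≤ 1 := by simp only [u, v]; rw [← NNReal.coe_le_coe]; push_cast; norm_num
      exact_mod_cast this
    · exact ((ENNReal.pow_pos (by simp) m).trans_le hc).ne'
    · intro z
      simpa using (RangeSpace.noShatter_dual hvc).ncard_patterns_le z
    · rintro x ⟨q, hq, hlt⟩
      refine ⟨q, (half_le_measure_sampleCount_le ν (hS q) (m := m) (by omega) ?_).trans
        (measure_mono fun y hy => ?_)⟩
      · rw [Fintype.card_fin, hN]
        have : (0 : ℝ) ≤ m := by positivity
        nlinarith
      · change c ≤ _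
        rw [pairWeight_elim]
        refine mul_le_mul' (pow_le_pow_right₀ ?_ (hh ▸ hq)) (pow_le_pow_of_le_one bot_le ?_ hy)
        · have : (1 : NNReal) ≤ u := by simp only [u]; rw [← NNReal.coe_le_coe]; push_cast; norm_num
          exact_mod_cast this
        · have : v ≤ 1 := by simp only [v]; rw [← NNReal.coe_le_coe]; push_cast; norm_num
          exact_mod_cast this
  have hbad' : M.real (toMeasurable M bad) ≤ 1 / 64 := by
    rw [measureReal_def, measure_toMeasurable]
    refine (ENNReal.toReal_mono (by simp) hbad).trans ?_
    norm_num
  by_cases hq : ∃ q, 1 ≤ 2 ^ j * ν.real (F.dual.range q)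
  · obtain ⟨q, hq⟩ := hq
    -- One fixed deep point suffices for the second property, so a tail bound without a union bound
    -- is enough.
    have hlow : M.real {x | sampleCount x (F.dual.range q) < heavyCount d j} ≤ 1 / 64 := by
      refine measure_sampleCount_lt_le ν (hS q) (by omega) ?_
      rw [Fintype.card_fin, hN, hh]
      have : (0 : ℝ) ≤ m := by positivity
      push_cast
      nlinarith
    have hlm : MeasurableSet {x : Fin (sampleSize d j) → ι | sampleCount x (F.dual.range q) < heavyCount d j} :=
      measurable_sampleCount (hS q) measurableSet_Iio
    refine ⟨(toMeasurable M bad ∪ {x | sampleCount x (F.dual.range q) < heavyCount d j})ᶜ,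
      ((measurableSet_toMeasurable _ _).union hlm).compl, ?_, ?_, ?_⟩
    · rw [probReal_compl_eq_one_sub ((measurableSet_toMeasurable _ _).union hlm)]
      have := measureReal_union_le (μ := M) (toMeasurable M bad)
        {x | sampleCount x (F.dual.range q) < heavyCount d j}
      linarith
    · intro x hx q' hq'
      by_contra! hlt
      exact hx (Or.inl (subset_toMeasurable M bad ⟨q', hq', hlt⟩))
    · intro _ x hx
      exact ⟨q, not_lt.1 fun h => hx (Or.inr h)⟩
  · refine ⟨(toMeasurable M bad)ᶜ, (measurableSet_toMeasurable _ _).compl, ?_, ?_, ?_⟩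
    · rw [probReal_compl_eq_one_sub (measurableSet_toMeasurable _ _)]
      linarith
    · intro x hx q' hq'
      by_contra! hlt
      exact hx (subset_toMeasurable M bad ⟨q', hq', hlt⟩)
    · exact fun h => absurd h hq

/-! ## Random samples of points -/

/-- The size of the random sample of points. -/
def netSize (d e j : ℕ) : ℕ := 4096 * d * 2 ^ j * (e + j + 32)

lemma netSize_arith {d e : ℕ} (hd : 1 ≤ d) (he : d ≤ 2 ^ e) (j : ℕ) :
    2 * (netSize d e j + netSize d e j + 1) ^ d * 2 ^ (j + 5) ≤ 2 ^ (8 * d * (e + j + 32)) := by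
  unfold netSize
  obtain ⟨M, hM⟩ : ∃ M, M = e + j + 32 := ⟨_, rfl⟩
  rw [← hM]
  have hMM : M < 2 ^ M := Nat.lt_two_pow_self
  have h1 : 4096 * d * 2 ^ j * M + 4096 * d * 2 ^ j * M + 1 ≤ 2 ^ (14 + e + j + M) := by
    have e1 : (2 : ℕ) ^ (14 + e + j + M) = 16384 * (2 ^ e * 2 ^ j * 2 ^ M) := by
      rw [pow_add, pow_add, pow_add]; ring
    rw [e1]
    have hM0 : 0 < M := by omega
    have h2 : 0 < d * 2 ^ j * M := by positivity
    have h3 : d * 2 ^ j * M ≤ 2 ^ e * 2 ^ j * 2 ^ M := by gcongr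
    rw [mul_assoc 4096, mul_assoc 4096]
    omega
  calc 2 * (4096 * d * 2 ^ j * M + 4096 * d * 2 ^ j * M + 1) ^ d * 2 ^ (j + 5)
      ≤ 2 * (2 ^ (14 + e + j + M)) ^ d * 2 ^ (j + 5) := by gcongr
    _ = 2 ^ (6 + j + (14 + e + j + M) * d) := by
        rw [← pow_mul, pow_add, pow_add]; ring
    _ ≤ _ := by
        refine Nat.pow_le_pow_right (by norm_num) ?_
        have : M ≤ d * M := Nat.le_mul_of_pos_left _ hd
        have : (14 + e + j + M) * d ≤ (2 * M) * d := by gcongr; omega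
        have : 8 * d * M = 8 * (d * M) := by ring
        have : 2 * M * d = 2 * (d * M) := by ring
        omega

/-- The uniform distribution on the indices of a list of length `n + 1`. -/
noncomputable def uniformIndex (n : ℕ) : Measure (Fin (n + 1)) :=
  (PMF.uniformOfFintype (Fin (n + 1))).toMeasure

instance (n : ℕ) : IsProbabilityMeasure (uniformIndex n) := by
  unfold uniformIndex; infer_instance

/-- A random sample of points from a list is likely to hit all ranges that contain a large
fraction of the list. -/
theorem measure_not_net_le {Q : Type u} {ι : Type v} {F : RangeSpace Q ι} {d e : ℕ} (hd : 1 ≤ d)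
    (hvc : F.vcDim ≤ d) (he : d ≤ 2 ^ e) (j n : ℕ) (P : Fin (n + 1) → Q) :
    (Measure.pi fun _ : Fin (netSize d e j) => uniformIndex n)
      {x | ∃ i, n + 1 ≤ 256 * 2 ^ j * sampleCount P (F.range i) ∧ ∀ k, P (x k) ∉ F.range i}
      ≤ (2 ^ (j + 5))⁻¹ := by
  classical
  let S : ι → Set (Fin (n + 1)) := fun i => P ⁻¹' F.range i
  let m := 8 * d * (e + j + 32)
  have hm : 32 ≤ m := by
    have : 0 < d := hd
    simp only [m]; nlinarith
  -- With `u = 0` and `v = 2` only patterns that miss the first half have positive weight. A missed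
  -- range has weight `0 ^ 0 * 2 ^ count`, at least `2 ^ m` as soon as the ghost sample hits it `m`
  -- times.
  refine (measure_bad_le (uniformIndex n) S (u := 0) (v := 2) (c := 2 ^ m) (by simp) (by simp)
    (by simp) (by simp) ((netSize d e j + netSize d e j + 1) ^ d) ?_
    (Set.toFinite _).measurableSet.nullMeasurableSet _ ?_).trans
    (two_mul_natCast_div_le (netSize_arith hd he j) le_rfl (by simp))
  · intro z
    simpa [S] using (RangeSpace.noShatter_range hvc).ncard_patterns_le fun k => P (z k)
  · rintro x ⟨i, hi, hx⟩
    refine ⟨i, ?_⟩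
    have hS : MeasurableSet (S i) := (Set.toFinite _).measurableSet
    have hν : (uniformIndex n).real (S i) = sampleCount P (F.range i) / (n + 1 : ℝ) := by
      rw [measureReal_def, uniformIndex, PMF.toMeasure_uniformOfFintype_apply _ hS]
      simp only [ENNReal.toReal_div, ENNReal.toReal_natCast, Fintype.card_fin]
      push_cast
      congr 2
      rw [sampleCount, Fintype.card_subtype]
      congr!
    have hlow := measure_sampleCount_lt_le (I := Fin (netSize d e j)) (uniformIndex n) hS hm (by
      rw [hν, Fintype.card_fin, ← mul_div_assoc, le_div_iff₀ (by positivity)]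
      have h1 : ((n : ℝ) + 1) ≤ 256 * 2 ^ j * sampleCount P (F.range i) := by exact_mod_cast hi
      have h2 : (netSize d e j : ℝ) = 2 * m * (256 * 2 ^ j) := by
        simp only [netSize, m]; push_cast; ring
      rw [h2, mul_assoc _ (256 * 2 ^ j : ℝ)]
      gcongr)
    set M := (Measure.pi fun _ : Fin (netSize d e j) => uniformIndex n)
    have hcompl : M.real {y | sampleCount y (S i) < m}ᶜ ≥ 1 / 2 := by
      rw [probReal_compl_eq_one_sub (Set.toFinite _).measurableSet]
      linarith
    have hge : 2⁻¹ ≤ M {y | sampleCount y (S i) < m}ᶜ := by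
      rw [← ofReal_measureReal]
      have : (2⁻¹ : ℝ≥0∞) = ENNReal.ofReal (1 / 2) := by
        rw [one_div, ENNReal.ofReal_inv_of_pos two_pos]; simp
      rw [this]
      exact ENNReal.ofReal_le_ofReal hcompl
    refine hge.trans (measure_mono fun y hy => ?_)
    have hy' : m ≤ sampleCount y (S i) := not_lt.1 hy
    have hx0 : sampleCount x (S i) = 0 := by
      rw [sampleCount, Finset.card_eq_zero, Finset.filter_eq_empty_iff]
      exact fun k _ => hx k
    change _ ≤ pairWeight _ _ _
    rw [pairWeight_elim, hx0, pow_zero, one_mul]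
    exact pow_le_pow_right₀ (by norm_num) hy'

namespace RangeSpace

variable {Q : Type u} {ι : Type v}

/-! ## The growth function -/

lemma encard_traces_le_growth (F : RangeSpace Q ι) {P : Finset Q} {r : ℕ} (h : P.card ≤ r) :
    (F.traces P).encard ≤ (F.growth r : ℕ∞) := by
  have hne : {m : ℕ | ∀ P : Finset Q, P.card ≤ r → (F.traces P).encard ≤ (m : ℕ∞)}.Nonempty := by
    refine ⟨2 ^ r, fun P hP => ?_⟩
    classical
    have hsub : F.traces P ⊆ (fun A : Finset Q => (A : Set Q)) '' (P.powerset : Set (Finset Q)) := by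
      rintro _ ⟨i, rfl⟩
      refine ⟨P.filter (· ∈ F.range i), Finset.mem_coe.2 (Finset.mem_powerset.2 (Finset.filter_subset _ _)), ?_⟩
      ext x
      simp [and_comm]
    refine ((Set.encard_le_encard hsub).trans (Set.encard_image_le _ _)).trans ?_
    rw [Set.encard_coe_eq_coe_finsetCard, Finset.card_powerset]
    norm_cast
    exact Nat.pow_le_pow_right (by norm_num) hP
  exact Nat.sInf_mem hne P h

lemma one_le_growth [Nonempty ι] (F : RangeSpace Q ι) (r : ℕ) : 1 ≤ F.growth r := by
  have h := F.encard_traces_le_growth (P := ∅) (r := r) (by simp)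
  have h1 : 1 ≤ (F.traces ∅).encard :=
    Set.one_le_encard_iff_nonempty.2 ⟨_, Classical.arbitrary ι, rfl⟩
  exact_mod_cast h1.trans h

/-- An infinite family of sets has at least `r + 1` traces on some set of at most `r` points. -/
lemma lt_growth_of_infinite {F : RangeSpace Q ι} (hF : (Set.range F.range).Infinite) (r : ℕ) :
    r < F.growth r := by
  classical
  suffices h : ∃ P : Finset Q, P.card ≤ r ∧ ((r + 1 : ℕ) : ℕ∞) ≤ (F.traces P).encard by
    obtain ⟨P, hP, hle⟩ := h
    exact_mod_cast hle.trans (F.encard_traces_le_growth hP)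
  induction r with
  | zero =>
    obtain ⟨_, i, rfl⟩ := hF.nonempty
    have : (F.traces ∅).Nonempty := ⟨_, i, rfl⟩
    exact ⟨∅, by simp, by simpa using this⟩
  | succ r ih =>
    obtain ⟨P, hP, hle⟩ := ih
    have hfin : (F.traces P).Finite := by
      refine (P.finite_toSet.finite_subsets).subset ?_
      rintro _ ⟨i, rfl⟩
      exact Set.inter_subset_right
    -- Two distinct ranges have the same trace on `P`. Adding a point that separates them splits
    -- this trace and so yields at least one new trace.
    obtain ⟨_, ⟨i, rfl⟩, _, ⟨i', rfl⟩, hne, heq⟩ := hF.exists_ne_map_eq_of_mapsTo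
      (f := fun A => A ∩ (P : Set Q)) (t := F.traces P)
      (by rintro _ ⟨i, rfl⟩; exact ⟨i, rfl⟩) hfin
    obtain ⟨q, hq⟩ : ∃ q, ¬ (q ∈ F.range i ↔ q ∈ F.range i') := by
      by_contra! h
      exact hne (Set.ext h)
    refine ⟨insert q P, (Finset.card_insert_le _ _).trans (by omega), ?_⟩
    let π : Set Q → Set Q := fun A => A ∩ P
    have hπ : ∀ k, π (F.range k ∩ (insert q P : Finset Q)) = F.range k ∩ P := by
      intro k
      ext x
      simp only [π, Set.mem_inter_iff, Finset.coe_insert, Set.mem_insert_iff, Finset.mem_coe]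
      tauto
    set A := F.range i ∩ ((insert q P : Finset Q) : Set Q)
    set A' := F.range i' ∩ ((insert q P : Finset Q) : Set Q)
    have hAA : A ≠ A' := by
      intro h
      apply hq
      have := Set.ext_iff.1 h q
      simpa [A, A'] using this
    have hsub : F.traces P ⊆ π '' (F.traces (insert q P) \ {A}) := by
      rintro _ ⟨k, rfl⟩
      by_cases hk : F.range k ∩ ((insert q P : Finset Q) : Set Q) = A
      · refine ⟨A', ⟨⟨i', rfl⟩, fun h => hAA h.symm⟩, ?_⟩
        rw [hπ i', ← hπ k, hk, hπ i]
        exact heq.symm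
      · exact ⟨_, ⟨⟨k, rfl⟩, hk⟩, hπ k⟩
    have h1 : ((r + 1 : ℕ) : ℕ∞) ≤ (F.traces (insert q P) \ {A}).encard :=
      hle.trans ((Set.encard_le_encard hsub).trans (Set.encard_image_le _ _))
    have hA : A ∈ F.traces (insert q P) := ⟨i, rfl⟩
    rw [← Set.encard_sdiff_singleton_add_one hA]
    push_cast at h1 ⊢
    gcongr

lemma length_subsys_le {F : RangeSpace Q ι} (O : Oracles F) (L : List ι) {r : ℕ}
    (hr : L.length ≤ r) : (O.subsys L).length ≤ F.dual.growth r := by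
  classical
  have hmem : ∀ A ∈ O.subsys L, ∃ q, A = F.through L q := fun A => (O.mem_subsys L A).1
  have hset : ∀ q, {i | i ∈ F.through L q} = F.dual.range q ∩ (L.toFinset : Set ι) := by
    intro q
    ext i
    simp [through, dual, and_comm]
  have hinj : Set.InjOn (fun A : List ι => {i | i ∈ A}) ((O.subsys L).toFinset : Set (List ι)) := by
    intro A hA B hB hAB
    obtain ⟨q, rfl⟩ := hmem A (by simpa using hA)
    obtain ⟨q', rfl⟩ := hmem B (by simpa using hB)
    refine List.filter_congr fun i hi => ?_
    have := Set.ext_iff.1 hAB i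
    simpa [through, hi] using this
  have h1 : ((O.subsys L).length : ℕ∞)
      = ((fun A : List ι => {i | i ∈ A}) '' ((O.subsys L).toFinset : Set (List ι))).encard := by
    rw [hinj.encard_image, Set.encard_coe_eq_coe_finsetCard,
      List.toFinset_card_of_nodup (O.subsys_nodup L)]
  have h2 : (fun A : List ι => {i | i ∈ A}) '' ((O.subsys L).toFinset : Set (List ι))
      ⊆ F.dual.traces L.toFinset := by
    rintro _ ⟨A, hA, rfl⟩
    obtain ⟨q, rfl⟩ := hmem A (by simpa using hA)
    exact ⟨q, hset q⟩
  have h3 := F.dual.encard_traces_le_growth (P := L.toFinset) ((List.toFinset_card_le L).trans hr)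
  exact_mod_cast h1.le.trans ((Set.encard_le_encard h2).trans h3)

/-! ## Optimal hitting sets -/

lemma exists_hittingSet_card_eq_opt {F : RangeSpace Q ι}
    (h : ∃ H : Finset Q, F.IsHittingSet (H : Set Q)) :
    ∃ H : Finset Q, F.IsHittingSet (H : Set Q) ∧ H.card = F.opt := by
  obtain ⟨H, hH⟩ := h
  exact Nat.sInf_mem (s := {n | ∃ H : Finset Q, F.IsHittingSet (H : Set Q) ∧ H.card = n})
    ⟨_, H, hH, rfl⟩

/-! ## Multiplicative weights -/

lemma hits_le_length (F : RangeSpace Q ι) (P : List Q) (i : ι) : F.hits P i ≤ P.length :=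
  List.countP_le_length

open scoped Classical in
lemma hits_append_singleton (F : RangeSpace Q ι) (P : List Q) (q : Q) (i : ι) :
    F.hits (P ++ [q]) i = F.hits P i + if q ∈ F.range i then 1 else 0 := by
  simp [hits, List.countP_append, List.countP_singleton]

section

variable [MeasurableSpace ι]

/-- The measure with density `2 ^ (-|P ∩ R|)`. -/
noncomputable def halved (F : RangeSpace Q ι) (w₀ : Measure ι) (P : List Q) : Measure ι :=
  reweight F w₀ P fun k => (1 / 2) ^ k

lemma reweight_eq_halved (F : RangeSpace Q ι) (w₀ : Measure ι) (P : List Q) {φ : ℕ → ℝ}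
    (h : ∀ k ≤ P.length, φ k = (1 / 2) ^ k) : reweight F w₀ P φ = F.halved w₀ P := by
  unfold halved reweight
  congr 1
  funext i
  rw [h _ (F.hits_le_length P i)]

lemma halved_le (F : RangeSpace Q ι) (w₀ : Measure ι) (P : List Q) : F.halved w₀ P ≤ w₀ := by
  unfold halved reweight
  conv_rhs => rw [← withDensity_one (μ := w₀)]
  refine withDensity_mono (Filter.Eventually.of_forall fun i => ?_)
  simp only [Pi.one_apply, ENNReal.ofReal_le_one]
  exact pow_le_one₀ (by norm_num) (by norm_num)

instance (F : RangeSpace Q ι) (w₀ : Measure ι) [IsFiniteMeasure w₀] (P : List Q) :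
    IsFiniteMeasure (F.halved w₀ P) := isFiniteMeasure_of_le w₀ (F.halved_le w₀ P)

lemma halved_nil (F : RangeSpace Q ι) (w₀ : Measure ι) : F.halved w₀ [] = w₀ := by
  simp only [halved, reweight, hits, List.countP_nil, pow_zero, ENNReal.ofReal_one]
  exact withDensity_one

end

variable [MeasurableSpace Q]

/-- The fractional optimum as an extended nonnegative real number. -/
noncomputable def fractionalInf (F : RangeSpace Q ι) : ℝ≥0∞ :=
  ⨅ (μ : Measure Q) (_ : ∀ i, 1 ≤ μ (F.range i)), μ Set.univ

lemma fractionalInf_le_opt {F : RangeSpace Q ι} (h : ∃ H : Finset Q, F.IsHittingSet (H : Set Q)) :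
    F.fractionalInf ≤ F.opt := by
  obtain ⟨H, hH, hc⟩ := exists_hittingSet_card_eq_opt h
  refine (iInf₂_le (∑ q ∈ H, Measure.dirac q) fun i => ?_).trans ?_
  · obtain ⟨q, hqH, hq⟩ := hH i
    rw [Measure.finsetSum_apply]
    calc (1 : ℝ≥0∞) = (F.range i).indicator 1 q := by simp [hq]
      _ ≤ Measure.dirac q (F.range i) := Measure.le_dirac_apply
      _ ≤ _ := Finset.single_le_sum (f := fun q => Measure.dirac q (F.range i))
        (fun _ _ => bot_le) hqH
  · rw [Measure.finsetSum_apply]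
    simp [hc]

lemma one_le_fractionalInf [Nonempty ι] (F : RangeSpace Q ι) : 1 ≤ F.fractionalInf :=
  le_iInf₂ fun _ hμ => (hμ (Classical.arbitrary ι)).trans (measure_mono (Set.subset_univ _))

lemma ofReal_fractionalOpt {F : RangeSpace Q ι} (h : ∃ H : Finset Q, F.IsHittingSet (H : Set Q)) :
    ENNReal.ofReal F.fractionalOpt = F.fractionalInf :=
  ENNReal.ofReal_toReal ((fractionalInf_le_opt h).trans_lt (by simp)).ne

lemma fractionalOpt_le_opt {F : RangeSpace Q ι} (h : ∃ H : Finset Q, F.IsHittingSet (H : Set Q)) :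
    F.fractionalOpt ≤ F.opt :=
  ENNReal.toReal_le_of_le_ofReal (by positivity)
    ((fractionalInf_le_opt h).trans (by simp))

lemma one_le_fractionalOpt [Nonempty ι] {F : RangeSpace Q ι}
    (h : ∃ H : Finset Q, F.IsHittingSet (H : Set Q)) : 1 ≤ F.fractionalOpt := by
  have := F.one_le_fractionalInf
  rwa [← ofReal_fractionalOpt h, ENNReal.one_le_ofReal] at this

/-- Weak duality: every distribution on the ranges has a point that hits a large fraction. -/
lemma exists_deep_point [MeasurableSpace ι] {F : RangeSpace Q ι} (hF : F.MeasurableIncidence)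
    {z : ℝ} (hz : F.fractionalInf < ENNReal.ofReal z) (ν : Measure ι) [IsProbabilityMeasure ν] :
    ∃ q, 1 ≤ z * ν.real (F.dual.range q) := by
  obtain ⟨μ, hμ⟩ := iInf_lt_iff.1 hz
  obtain ⟨hμ1, hμ2⟩ := iInf_lt_iff.1 hμ
  have : IsFiniteMeasure μ := ⟨hμ2.trans_le le_top⟩
  have hz0 : 0 < z := by
    by_contra! h
    rw [ENNReal.ofReal_of_nonpos h] at hμ2
    exact not_lt_bot hμ2
  by_contra! hlt
  -- Double counting of incidences: integrated over ranges they have mass at least one; integrated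
  -- over points, less than one if no point is deep.
  have h1 : (1 : ℝ≥0∞) ≤ (ν.prod μ) (Prod.swap ⁻¹' {x : Q × ι | x.1 ∈ F.range x.2}) := by
    rw [Measure.prod_apply (hF.preimage measurable_swap)]
    calc (1 : ℝ≥0∞) = ∫⁻ _, 1 ∂ν := by simp
      _ ≤ _ := lintegral_mono fun i => hμ1 i
  have h2 : (ν.prod μ) (Prod.swap ⁻¹' {x : Q × ι | x.1 ∈ F.range x.2}) ≤ ENNReal.ofReal z⁻¹ * μ Set.univ := by
    rw [Measure.prod_apply_symm (hF.preimage measurable_swap), ← lintegral_const]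
    refine lintegral_mono fun q => ?_
    change ν (F.dual.range q) ≤ _
    rw [← ofReal_measureReal]
    refine ENNReal.ofReal_le_ofReal ?_
    exact (le_inv_mul_iff₀ hz0).2 (hlt q).le |>.trans (by simp)
  have h3 : ENNReal.ofReal z⁻¹ * μ Set.univ < 1 := by
    calc ENNReal.ofReal z⁻¹ * μ Set.univ < ENNReal.ofReal z⁻¹ * ENNReal.ofReal z :=
          (ENNReal.mul_lt_mul_iff_right (by simpa using hz0) (by simp)).2 hμ2
      _ = 1 := by
          rw [← ENNReal.ofReal_mul (by positivity), inv_mul_cancel₀ hz0.ne']; simp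
  exact absurd (h1.trans h2) (not_le.2 h3)

/-- The least power of two above the fractional optimum. The inequality must be strict because the
infimum need not be attained. -/
lemma exists_guess [Nonempty ι] [MeasurableSpace ι] {F : RangeSpace Q ι}
    (hF : F.MeasurableIncidence) (h : ∃ H : Finset Q, F.IsHittingSet (H : Set Q)) :
    ∃ j : ℕ, (2 : ℝ) ^ j ≤ 2 * F.fractionalOpt ∧ ∀ (ν : Measure ι) [IsProbabilityMeasure ν],
      ∃ q, 1 ≤ 2 ^ j * ν.real (F.dual.range q) := by
  have hex : ∃ j : ℕ, F.fractionalOpt < 2 ^ j := pow_unbounded_of_one_lt _ (by norm_num)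
  classical
  refine ⟨Nat.find hex, ?_, fun ν _ => exists_deep_point hF ?_ ν⟩
  · have h1 := one_le_fractionalOpt h
    rcases Nat.eq_zero_or_pos (Nat.find hex) with h0 | h0
    · rw [h0]; linarith
    · have : ¬ F.fractionalOpt < 2 ^ (Nat.find hex - 1) := Nat.find_min hex (Nat.sub_lt h0 one_pos)
      rw [← Nat.sub_add_cancel h0, pow_succ]
      linarith [not_lt.1 this]
  · rw [← ofReal_fractionalOpt h]
    exact (ENNReal.ofReal_lt_ofReal_iff (by positivity)).2 (Nat.find_spec hex)

variable [MeasurableSpace ι]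

lemma measurable_hits {F : RangeSpace Q ι} (hF : F.MeasurableIncidence) (P : List Q) :
    Measurable (F.hits P) := by
  classical
  induction P using List.reverseRecOn with
  | nil => exact measurable_const (a := (0 : ℕ))
  | append_singleton P q ih =>
    have : F.hits (P ++ [q]) = fun i => F.hits P i + if q ∈ F.range i then 1 else 0 :=
      funext fun i => hits_append_singleton F P q i
    rw [this]
    exact ih.add (Measurable.ite (hF.measurableSet_dual q) measurable_const measurable_const)

lemma measurable_halved_density {F : RangeSpace Q ι} (hF : F.MeasurableIncidence) (P : List Q) :
    Measurable fun i => ENNReal.ofReal ((1 / 2) ^ F.hits P i) :=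
  (measurable_from_top (f := fun k : ℕ => ENNReal.ofReal ((1 / 2) ^ k))).comp (measurable_hits hF P)

/-- A range hit at most `m` times still has density at least `2 ^ (-m)`, so the remaining weight
controls the measure of such ranges. -/
lemma light_measure_le {F : RangeSpace Q ι} (hF : F.MeasurableIncidence) (w₀ : Measure ι)
    [IsFiniteMeasure w₀] (P : List Q) (m : ℕ) :
    w₀.real {i | F.hits P i ≤ m} ≤ 2 ^ m * (F.halved w₀ P).real Set.univ := by
  have hm : MeasurableSet {i | F.hits P i ≤ m} := measurable_hits hF P measurableSet_Iic
  have h : ENNReal.ofReal ((1 / 2) ^ m) * w₀ {i | F.hits P i ≤ m} ≤ F.halved w₀ P Set.univ := by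
    rw [← setLIntegral_const]
    refine le_trans ?_ (measure_mono (Set.subset_univ {i | F.hits P i ≤ m}))
    rw [halved, reweight, withDensity_apply _ hm]
    refine setLIntegral_mono (measurable_halved_density hF P) fun i hi => ?_
    exact ENNReal.ofReal_le_ofReal (pow_le_pow_of_le_one (by norm_num) (by norm_num) hi)
  have h' := ENNReal.toReal_mono (measure_ne_top _ _) h
  rw [ENNReal.toReal_mul, ENNReal.toReal_ofReal (by positivity)] at h'
  change (1 / 2) ^ m * w₀.real _ ≤ (F.halved w₀ P).real _ at h'
  calc w₀.real {i | F.hits P i ≤ m} = 2 ^ m * ((1 / 2) ^ m * w₀.real {i | F.hits P i ≤ m}) := by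
        rw [← mul_assoc, ← mul_pow]; norm_num
    _ ≤ _ := by gcongr

lemma halved_univ_pos {F : RangeSpace Q ι} (hF : F.MeasurableIncidence) (w₀ : Measure ι)
    [IsFiniteMeasure w₀] (hw : w₀ ≠ 0) (P : List Q) : 0 < (F.halved w₀ P).real Set.univ := by
  have h := light_measure_le hF w₀ P P.length
  have : {i | F.hits P i ≤ P.length} = Set.univ := Set.eq_univ_of_forall fun i => F.hits_le_length P i
  rw [this] at h
  have h0 : 0 < w₀.real Set.univ := by
    rw [measureReal_def]
    exact ENNReal.toReal_pos (by simpa using hw) (measure_ne_top _ _)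
  by_contra! hle
  have := mul_nonpos_of_nonneg_of_nonpos (by positivity : (0 : ℝ) ≤ 2 ^ P.length) hle
  linarith

/-- Appending `q` halves the density exactly on the ranges through `q`. -/
lemma halved_append {F : RangeSpace Q ι} (hF : F.MeasurableIncidence) (w₀ : Measure ι)
    [IsFiniteMeasure w₀] (P : List Q) (q : Q) :
    (F.halved w₀ (P ++ [q])).real Set.univ
      = (F.halved w₀ P).real Set.univ - (F.halved w₀ P).real (F.dual.range q) / 2 := by
  classical
  have hS := hF.measurableSet_dual q
  have h : F.halved w₀ (P ++ [q]) Set.univ + ENNReal.ofReal (1 / 2) * F.halved w₀ P (F.dual.range q)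
      = F.halved w₀ P Set.univ := by
    simp only [halved, reweight]
    rw [withDensity_apply _ hS, withDensity_apply _ MeasurableSet.univ,
      withDensity_apply _ MeasurableSet.univ, Measure.restrict_univ,
      ← lintegral_const_mul _ (measurable_halved_density hF P),
      ← lintegral_indicator hS, ← lintegral_add_left (measurable_halved_density hF _)]
    congr 1
    funext i
    rw [hits_append_singleton]
    by_cases hq : q ∈ F.range i
    · have : i ∈ F.dual.range q := hq
      rw [Set.indicator_of_mem this, if_pos hq, ← ENNReal.ofReal_mul (by norm_num),
        ← ENNReal.ofReal_add (by positivity) (by positivity)]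
      congr 1
      ring
    · have : i ∉ F.dual.range q := hq
      rw [Set.indicator_of_notMem this, if_neg hq]
      simp
  have h' := congrArg ENNReal.toReal h
  rw [ENNReal.toReal_add (measure_ne_top _ _) (ENNReal.mul_ne_top (by simp) (measure_ne_top _ _)),
    ENNReal.toReal_mul, ENNReal.toReal_ofReal (by norm_num)] at h'
  simp only [measureReal_def]
  linarith

end RangeSpace

/-! ## The program -/

/-- The content of register `n`. -/
def NExp.reg (n : ℕ) : NExp := .load (.const n)

/-- Double register `a` and increase register `k` as long as `b` holds. -/
def Cmd.doubling (b : BExp) (a k : ℕ) : Cmd :=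
  .loop b (.seq (.setNat (.const a) (.add (.reg a) (.reg a)))
    (.setNat (.const k) (.add (.reg k) (.const 1))))

namespace Algorithm

open NExp (reg)

/-- The size of the sample of ranges. -/
def sampleExp : NExp :=
  .mul (.mul (.mul (.const 512) (reg 0)) (reg 1)) (.mul (reg 7) (reg 7))

/-- The number of sampled ranges that a selected point has to hit. -/
def heavyExp : NExp := .mul (.mul (.mul (.const 256) (reg 0)) (reg 1)) (reg 7)

/-- The number of rounds of a phase. -/
def roundsExp : NExp :=
  .mul (.mul (.const 256) (reg 7)) (.add (.add (reg 4) (reg 8)) (.const 8))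

/-- The size of the output. -/
def netExp : NExp :=
  .mul (.mul (.mul (.const 4096) (reg 0)) (reg 7)) (.add (.add (reg 6) (reg 8)) (.const 32))

/-- Search the list of families for one of large cardinality. -/
def scan : Cmd :=
  .loop (.conj (.ltN (reg 10) (.numFam 0)) (.ltN (.cardFam 0 (reg 10)) heavyExp))
    (.setNat (.const 10) (.add (reg 10) (.const 1)))

/-- Look for a point that hits many of the sampled ranges and append it to list `1`. -/
def select : Cmd :=
  .seq (.subsys 0 0) (.seq (.setNat (.const 10) (.const 0)) (.seq scan
    (.seq (.branch (.ltN (reg 10) (.numFam 0)) (.pointIn 1 0 (reg 10))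
      (.setNat (.const 10) (.const 0)))
      (.setNat (.const 9) (.add (reg 9) (.const 1))))))

/-- One round of the multiplicative weights method: extend the table of weights, sample ranges and
select a point. -/
def round : Cmd :=
  -- Real cell `2 + k` holds `2 ^ (-k)`. The table is filled one entry beyond `|P|`, so that it
  -- remains long enough if this round selects a point.
  .seq (.setReal (.add (.const 3) (.numPts 1))
      (.div (.load (.add (.const 2) (.numPts 1))) (.const 2)))
    (.seq (.sample 0 1 (.const 2) sampleExp) select)

/-- Output a random sample of the points of list `1`. -/
def net : Cmd :=
  .seq (.setNat (.const 11) (.const 0)) (.loop (.ltN (reg 11) netExp)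
    (.seq (.rand (.const 12) (.sub (.numPts 1) (.const 1))) (.seq (.push 0 1 (reg 12))
      (.setNat (.const 11) (.add (reg 11) (.const 1))))))

/-- After the rounds of a phase: output a sample if at least half of the rounds were successful,
otherwise double the guess. -/
def decision : Cmd :=
  .branch (.ltN (.add (.numPts 1) (.numPts 1)) roundsExp)
    (.seq (.setNat (.const 7) (.add (reg 7) (reg 7))) (.setNat (.const 8) (.add (reg 8) (.const 1))))
    (.seq net (.setNat (.const 13) (.const 1)))

/-- The work for one guess of the fractional optimum. -/
def phase : Cmd :=
  .seq (.clear 1) (.seq (.setNat (.const 9) (.const 0))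
    (.seq (.loop (.ltN (reg 9) roundsExp) round) decision))

/-- Compute `2 ^ d` and logarithms of `d` and `1 / δ`. -/
def prepare : Cmd :=
  -- Registers 1 and 2 end as `2 ^ d` and `d`, registers 3 and 4 as `2 ^ l` and `l`, registers 5 and
  -- 6 as `2 ^ e` and `e`, with `l` and `e` minimal such that `2 ^ l * δ ≥ 1` and `2 ^ e ≥ d`.
  -- Register 7 holds the guess, register 8 its logarithm; register 13 is the halting flag.
  .seq (.setNat (.const 1) (.const 1)) (.seq (.doubling (.ltN (reg 2) (reg 0)) 1 2)
    (.seq (.setNat (.const 3) (.const 1))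
      (.seq (.doubling (.ltR (.mul (.ofNat (reg 3)) (.load (.const 1))) (.const 1)) 3 4)
        (.seq (.setNat (.const 5) (.const 1)) (.seq (.doubling (.ltN (reg 5) (reg 0)) 5 6)
          (.seq (.setReal (.const 2) (.const 1)) (.setNat (.const 7) (.const 1))))))))

/-- The hitting set algorithm. -/
def main : Cmd := .seq prepare (.loop (.ltN (reg 13) (.const 1)) phase)

end Algorithm

/-! ## Rules for lower bounds on expectations -/

section Rules

lemma loopExp_succ_of_pos {Q : Type u} {ι : Type v} {b : State Q ι → Prop} {body : (State Q ι → ℝ≥0∞) → State Q ι → ℝ≥0∞}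
    {f : State Q ι → ℝ≥0∞} {s : State Q ι} (h : b s) (n : ℕ) :
    loopExp b body f (n + 1) s = body (loopExp b body f n) (s.tick 1) := by
  rw [loopExp, if_pos h]

lemma loopExp_succ_of_neg {Q : Type u} {ι : Type v} {b : State Q ι → Prop} {body : (State Q ι → ℝ≥0∞) → State Q ι → ℝ≥0∞}
    {f : State Q ι → ℝ≥0∞} {s : State Q ι} (h : ¬ b s) (n : ℕ) :
    loopExp b body f (n + 1) s = f (s.tick 1) := by
  rw [loopExp, if_neg h]

variable {Q : Type u} {ι : Type v} [MeasurableSpace ι] (F : RangeSpace Q ι) (w₀ : Measure ι)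
  (O : Oracles F) (f : State Q ι → ℝ≥0∞) (s : State Q ι)

lemma expect_setNat (a e : NExp) : expect F w₀ O (.setNat a e) f s
    = f ((s.setNat (a.eval s) (e.eval s)).tick 1) := rfl

lemma expect_setReal (a : NExp) (e : RExp) : expect F w₀ O (.setReal a e) f s
    = f ((s.setReal (a.eval s) (e.eval s)).tick 1) := rfl

lemma expect_clear (p : ℕ) : expect F w₀ O (.clear p) f s = f ((s.setPts p []).tick 1) := rfl

lemma expect_push (p p' : ℕ) (j : NExp) : expect F w₀ O (.push p p' j) f s
    = f ((s.setPts p (s.pts p ++ ((s.pts p')[j.eval s]?).toList)).tick 1) := rfl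

lemma expect_subsys (g r : ℕ) : expect F w₀ O (.subsys g r) f s
    = f ((s.setFam g (O.subsys (s.rgs r))).tick (1 + (O.subsys (s.rgs r)).length)) := rfl

lemma expect_pointIn (p g : ℕ) (k : NExp) : expect F w₀ O (.pointIn p g k) f s
    = f ((s.setPts p (s.pts p ++ (((s.fam g)[k.eval s]?).bind O.pointIn).toList)).tick 1) := rfl

lemma expect_seq (c₁ c₂ : Cmd) : expect F w₀ O (.seq c₁ c₂) f s
    = expect F w₀ O c₁ (expect F w₀ O c₂ f) s := rfl

lemma expect_branch_of_pos {b : BExp} (c₁ c₂ : Cmd) (h : b.eval F s) :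
    expect F w₀ O (.branch b c₁ c₂) f s = expect F w₀ O c₁ f (s.tick 1) := by
  rw [expect, if_pos h]

lemma expect_branch_of_neg {b : BExp} (c₁ c₂ : Cmd) (h : ¬ b.eval F s) :
    expect F w₀ O (.branch b c₁ c₂) f s = expect F w₀ O c₂ f (s.tick 1) := by
  rw [expect, if_neg h]

lemma loopExp_le_expect (b : BExp) (c : Cmd) (n : ℕ) :
    loopExp (fun t => b.eval F t) (expect F w₀ O c) f n s ≤ expect F w₀ O (.loop b c) f s :=
  le_iSup (fun n => loopExp (fun t => b.eval F t) (expect F w₀ O c) f n s) n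

/-- A loop whose body acts deterministically. -/
lemma le_expect_loop_of_trace (b : BExp) (c : Cmd) (σ : ℕ → State Q ι) (n : ℕ)
    (hb : ∀ i < n, b.eval F (σ i)) (hn : ¬ b.eval F (σ n))
    (hc : ∀ i < n, ∀ g, g (σ (i + 1)) ≤ expect F w₀ O c g ((σ i).tick 1)) :
    f ((σ n).tick 1) ≤ expect F w₀ O (.loop b c) f (σ 0) := by
  refine le_trans ?_ (loopExp_le_expect F w₀ O f (σ 0) b c (n + 1))
  have key : ∀ m i, i + m = n →
      f ((σ n).tick 1) ≤ loopExp (fun t => b.eval F t) (expect F w₀ O c) f (m + 1) (σ i) := by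
    intro m
    induction m with
    | zero =>
      rintro i rfl
      rw [loopExp_succ_of_neg hn]
      rfl
    | succ m ih =>
      intro i hi
      rw [loopExp_succ_of_pos (hb i (by omega))]
      exact (ih (i + 1) (by omega)).trans (hc i (by omega) _)
  exact key n 0 (by omega)

/-- Each pass costs one test and two assignments, and the failing test costs one more step. -/
lemma le_expect_doubling {b : BExp} {a k : ℕ} (hak : a ≠ k) (p : ℕ → Prop) (n : ℕ)
    (hb : ∀ i m, b.eval F { s with
      nat := Function.update (Function.update s.nat a (2 ^ i)) k i, steps := m } ↔ p i)
    (hp : ∀ i < n, p i) (hn : ¬ p n) (ha : s.nat a = 1) (hk : s.nat k = 0) :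
    f { s with nat := Function.update (Function.update s.nat a (2 ^ n)) k n,
               steps := s.steps + 3 * n + 1 } ≤ expect F w₀ O (.doubling b a k) f s := by
  have h0 : s = { s with nat := Function.update (Function.update s.nat a (2 ^ 0)) k 0,
                         steps := s.steps + 3 * 0 } := by
    rw [pow_zero, ← ha, Function.update_eq_self, ← hk, Function.update_eq_self, hk]
    rfl
  have h := le_expect_loop_of_trace F w₀ O f b (.seq (.setNat (.const a) (.add (.reg a) (.reg a)))
    (.setNat (.const k) (.add (.reg k) (.const 1))))
    (fun i => { s with nat := Function.update (Function.update s.nat a (2 ^ i)) k i,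
                       steps := s.steps + 3 * i }) n
    (fun i hi => (hb i _).2 (hp i hi)) (fun h => hn ((hb n _).1 h)) ?_
  · refine le_trans (le_of_eq ?_) (h.trans (le_of_eq ?_))
    · rfl
    · rw [← h0, Cmd.doubling]
  · intro i _ g
    rw [expect_seq, expect_setNat, expect_setNat]
    refine le_of_eq (congrArg g ?_)
    simp only [State.tick, State.setNat, NExp.eval, NExp.reg, Function.update_self,
      Function.update_of_ne hak, State.mk.injEq, and_true, true_and]
    refine ⟨?_, by ring⟩
    funext x
    by_cases hx : x = k
    · subst hx; simp [hak.symm]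
    · by_cases hx' : x = a
      · subst hx'; simp [hak]; ring
      · simp [hx, hx']

/-- The continuation may fail to be measurable in the sample; it is bounded below by a two-valued
function, which is measurable because `G` is. -/
lemma le_expect_sample (r p : ℕ) (base m : NExp) {μ : Measure ι} [IsFiniteMeasure μ] {N : ℕ}
    (hm : m.eval s = N)
    (hμ : reweight F w₀ (s.pts p) (fun k => s.real (base.eval s + k)) = μ) (hμ0 : μ ≠ 0)
    {G : Set (Fin N → ι)} (hG : MeasurableSet G) {a b q : ℝ} (hba : b ≤ a)
    (hGq : q ≤ (Measure.pi fun _ : Fin N => (μ Set.univ)⁻¹ • μ).real G)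
    (ha : ∀ x ∈ G, ENNReal.ofReal a ≤ f (((s.setRgs r (List.ofFn x)).addDraws N).tick 1))
    (hb : ∀ x : Fin N → ι,
      ENNReal.ofReal b ≤ f (((s.setRgs r (List.ofFn x)).addDraws N).tick 1)) :
    ENNReal.ofReal (q * a + (1 - q) * b) ≤ expect F w₀ O (.sample r p base m) f s := by
  subst hm
  have hμ1 : μ Set.univ ≠ 0 := by simpa using hμ0
  have : NeZero μ := ⟨hμ0⟩
  rw [expect, hμ, drawExp, if_neg hμ1]
  set M := Measure.pi fun _ : Fin (m.eval s) => (μ Set.univ)⁻¹ • μ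
  have hMG : M.real G ≤ 1 := measureReal_le_one
  have hMG0 : 0 ≤ M.real G := measureReal_nonneg
  calc ENNReal.ofReal (q * a + (1 - q) * b)
      ≤ ENNReal.ofReal (a * M.real G + b * M.real Gᶜ) := by
        refine ENNReal.ofReal_le_ofReal ?_
        rw [probReal_compl_eq_one_sub hG]
        nlinarith
    _ ≤ ENNReal.ofReal (a * M.real G) + ENNReal.ofReal (b * M.real Gᶜ) := ENNReal.ofReal_add_le
    _ = ENNReal.ofReal a * M G + ENNReal.ofReal b * M Gᶜ := by
        rw [ENNReal.ofReal_mul' hMG0, ENNReal.ofReal_mul' measureReal_nonneg, ofReal_measureReal,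
          ofReal_measureReal]
    _ = ∫⁻ x, G.indicator (fun _ => ENNReal.ofReal a) x
          + Gᶜ.indicator (fun _ => ENNReal.ofReal b) x ∂M := by
        rw [lintegral_add_left (measurable_const.indicator hG), lintegral_indicator_const hG,
          lintegral_indicator_const hG.compl]
    _ ≤ _ := by
        refine lintegral_mono fun x => ?_
        by_cases hx : x ∈ G
        · simpa [hx] using ha x hx
        · simpa [hx] using hb x

end Rules

/-! ### Selecting a point from the families listed by the oracle -/

section Search

lemma countP_ofFn {X : Type*} (S : Set X) [DecidablePred (· ∈ S)] {n : ℕ} (x : Fin n → X) :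
    (List.ofFn x).countP (fun a => decide (a ∈ S)) = sampleCount x S := by
  classical
  unfold sampleCount
  rw [List.ofFn_eq_map, List.countP_map, List.countP_eq_length_filter,
    ← List.toFinset_card_of_nodup ((List.nodup_finRange n).filter _)]
  congr 1
  ext k
  simp

variable {Q : Type u} {ι : Type v}

lemma RangeSpace.length_through_ofFn (F : RangeSpace Q ι) {n : ℕ} (x : Fin n → ι) (q : Q) :
    (F.through (List.ofFn x) q).length = sampleCount x (F.dual.range q) := by
  classical
  rw [← countP_ofFn, List.countP_eq_length_filter]
  rfl

namespace Algorithm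

/-- The contents of the memory before a round: `d`, the logarithms `l` and `e`, the guess `2 ^ j`,
the points `P` selected so far in the current phase, the number `t` of rounds of this phase,
and bounds `A` and `B` on the counters. -/
structure Config (s : State Q ι) (d l e j : ℕ) (P : List Q) (t A B : ℕ) : Prop where
  dim : s.nat 0 = d
  pow : s.nat 1 = 2 ^ d
  logDelta : s.nat 4 = l
  logDim : s.nat 6 = e
  guess : s.nat 7 = 2 ^ j
  logGuess : s.nat 8 = j
  running : s.nat 13 = 0
  empty : s.pts 0 = []
  points : s.pts 1 = P
  rounds : s.nat 9 = t
  table : ∀ k ≤ P.length, s.real (2 + k) = (1 / 2) ^ k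
  length_le : P.length ≤ t
  steps_le : s.steps ≤ A
  draws_le : s.draws ≤ B

variable {F : RangeSpace Q ι} {O : Oracles F} {d l e j t A B : ℕ} {P : List Q} {s : State Q ι}

lemma Config.mono (h : Config s d l e j P t A B) {A' B' : ℕ} (hA : A ≤ A') (hB : B ≤ B') :
    Config s d l e j P t A' B' :=
  { h with steps_le := h.steps_le.trans hA, draws_le := h.draws_le.trans hB }

lemma Config.tick (h : Config s d l e j P t A B) (k : ℕ) :
    Config (s.tick k) d l e j P t (A + k) B :=
  { h with steps_le := Nat.add_le_add_right h.steps_le k }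

lemma Config.sampleExp_eval (h : Config s d l e j P t A B) :
    sampleExp.eval s = sampleSize d j := by
  simp only [sampleExp, NExp.eval, NExp.reg, h.dim, h.pow, h.guess, sampleSize]
  ring

/-- The number of rounds of a phase. -/
def roundCount (l j : ℕ) : ℕ := 256 * 2 ^ j * (l + j + 8)

lemma Config.roundsExp_eval (h : Config s d l e j P t A B) :
    roundsExp.eval s = roundCount l j := by
  simp only [roundsExp, NExp.eval, NExp.reg, h.logDelta, h.logGuess, h.guess, roundCount]

lemma Config.netExp_eval (h : Config s d l e j P t A B) :
    netExp.eval s = netSize d e j := by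
  simp only [netExp, NExp.eval, NExp.reg, h.dim, h.guess, h.logDim, h.logGuess, netSize]

variable [MeasurableSpace ι] {w₀ : Measure ι}

/-- The search stops at the first large family. -/
lemma le_expect_scan {f : State Q ι → ℝ≥0∞} {v : ℝ≥0∞} {h : ℕ} (h0 : s.nat 10 = 0)
    (hh : ∀ k m, heavyExp.eval { s with nat := Function.update s.nat 10 k, steps := m } = h)
    (hf : ∀ k ≤ (s.fam 0).length, (∀ i < k, ((s.fam 0).getD i []).length < h) →
      (k < (s.fam 0).length → h ≤ ((s.fam 0).getD k []).length) →
      v ≤ f { s with nat := Function.update s.nat 10 k, steps := s.steps + (2 * k + 1) }) :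
    v ≤ expect F w₀ O scan f s := by
  classical
  have hex : ∃ k, ¬ (k < (s.fam 0).length ∧ ((s.fam 0).getD k []).length < h) :=
    ⟨(s.fam 0).length, by simp⟩
  set n := Nat.find hex with hn
  have hmin : ∀ i < n, i < (s.fam 0).length ∧ ((s.fam 0).getD i []).length < h := fun i hi =>
    not_not.1 (Nat.find_min hex hi)
  have hspec := Nat.find_spec hex
  rw [← hn] at hspec
  have hle : n ≤ (s.fam 0).length := by
    by_contra! hlt
    exact lt_irrefl _ (hmin _ hlt).1
  refine (hf n hle (fun i hi => (hmin i hi).2) fun hlt => ?_).trans ?_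
  · by_contra! hlt'
    exact hspec ⟨hlt, hlt'⟩
  · have hb : ∀ k m, BExp.eval F { s with nat := Function.update s.nat 10 k, steps := m }
        (.conj (.ltN (.reg 10) (.numFam 0)) (.ltN (.cardFam 0 (.reg 10)) heavyExp)) ↔
        (k < (s.fam 0).length ∧ ((s.fam 0).getD k []).length < h) := by
      intro k m
      simp only [BExp.eval, hh]
      simp [NExp.eval, NExp.reg]
    have hs : s = { s with nat := Function.update s.nat 10 0, steps := s.steps + 2 * 0 } := by
      rw [← h0, Function.update_eq_self, h0]
      rfl
    have key := le_expect_loop_of_trace F w₀ O f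
      (.conj (.ltN (.reg 10) (.numFam 0)) (.ltN (.cardFam 0 (.reg 10)) heavyExp))
      (.setNat (.const 10) (.add (.reg 10) (.const 1)))
      (fun k => { s with nat := Function.update s.nat 10 k, steps := s.steps + 2 * k }) n
      (fun i hi => (hb i _).2 (hmin i hi)) (fun h => hspec ((hb n _).1 h)) ?_
    · refine le_trans (le_of_eq rfl) (key.trans (le_of_eq ?_))
      rw [← hs, scan]
    · intro i _ g
      rw [expect_setNat]
      refine le_of_eq (congrArg g ?_)
      simp only [State.tick, State.setNat, NExp.eval, NExp.reg, Function.update_self,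
        Function.update_idem, State.mk.injEq, and_true, true_and]
      ring

/-- A point is selected if and only if some point hits many of the sampled ranges. -/
lemma le_expect_select {f : State Q ι → ℝ≥0∞} {v : ℝ≥0∞} (hs : Config s d l e j P t A B)
    (ht : s.real (2 + (P.length + 1)) = (1 / 2) ^ (P.length + 1)) {g : ℕ}
    (hg : (O.subsys (s.rgs 0)).length ≤ g)
    (hf : ∀ s' P', Config s' d l e j P' (t + 1) (A + (3 * g + 6)) B →
      ((P' = P ∧ ∀ q, (F.through (s.rgs 0) q).length < heavyCount d j) ∨
        ∃ q, P' = P ++ [q] ∧ heavyCount d j ≤ (F.through (s.rgs 0) q).length) → v ≤ f s') :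
    v ≤ expect F w₀ O select f s := by
  classical
  set L := s.rgs 0 with hL
  rw [select, expect_seq, expect_subsys, expect_seq, expect_setNat, expect_seq]
  refine le_expect_scan (h := heavyCount d j) (by simp [State.tick, State.setNat, NExp.eval]) ?_ ?_
  · intro k m
    simp only [heavyExp, NExp.eval, NExp.reg, heavyCount, State.setNat, State.tick, State.setFam]
    simp [hs.dim, hs.pow, hs.guess]
  · intro k hk hlight hheavy
    have hfam : ((((s.setFam 0 (O.subsys (s.rgs 0))).tick
      (1 + (O.subsys (s.rgs 0)).length)).setNat 10 0).tick 1).fam 0 = O.subsys L := by simp [State.setFam, State.tick, State.setNat, hL]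
    simp only [NExp.eval] at hk hlight hheavy
    rw [hfam] at hk hlight hheavy
    have hsteps := hs.steps_le
    rw [expect_seq]
    by_cases hkl : k < (O.subsys L).length
    · rw [expect_branch_of_pos]
      swap
      · simpa [BExp.eval, NExp.eval, NExp.reg, State.tick, State.setNat, State.setFam] using hkl
      have hA : (O.subsys L).getD k [] ∈ O.subsys L := by
        rw [List.getD_eq_getElem _ _ hkl]; exact List.getElem_mem hkl
      obtain ⟨q₀, hq₀⟩ := (O.mem_subsys L _).1 hA
      have hq₀' : (O.subsys L)[k]? = some (F.through L q₀) := by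
        rw [List.getElem?_eq_getElem hkl, ← hq₀, List.getD_eq_getElem _ _ hkl]
      obtain ⟨q, hq⟩ : ∃ q, O.pointIn (F.through L q₀) = some q := by
        rcases hopt : O.pointIn (F.through L q₀) with _ | q
        · refine absurd ⟨q₀, fun i hi => ?_⟩ (O.pointIn_none _ hopt)
          simpa using (List.mem_filter.1 hi).2
        · exact ⟨q, rfl⟩
      have hqA := O.pointIn_some _ _ hq
      rw [expect_pointIn, expect_setNat]
      refine hf _ (P ++ [q]) ?_ (Or.inr ⟨q, rfl, ?_⟩)
      · constructor <;>
          simp [State.tick, State.setNat, State.setFam, State.setPts, NExp.eval, NExp.reg, ← hL,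
            hs.dim, hs.pow, hs.logDelta, hs.logDim, hs.guess, hs.logGuess, hs.running, hs.empty,
            hs.points, hs.rounds, hq₀', hq, hs.length_le, hs.draws_le]
        · intro m hm
          rcases Nat.le_succ_iff.1 hm with h | h
          · simpa using hs.table m h
          · subst h; simpa using ht
        · omega
      · refine (hheavy hkl).trans ?_
        rw [hq₀]
        simp only [RangeSpace.through, ← List.countP_eq_length_filter]
        refine List.countP_mono_left fun i hi h => ?_
        simpa using hqA i (List.mem_filter.2 ⟨hi, h⟩)
    · rw [expect_branch_of_neg]
      swap
      · simpa [BExp.eval, NExp.eval, NExp.reg, State.tick, State.setNat, State.setFam] using hkl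
      rw [expect_setNat, expect_setNat]
      refine hf _ P ?_ (Or.inl ⟨rfl, fun q => ?_⟩)
      · constructor <;>
          try simp [State.tick, State.setNat, State.setFam, NExp.eval, NExp.reg, ← hL,
            hs.dim, hs.pow, hs.logDelta, hs.logDim, hs.guess, hs.logGuess, hs.running, hs.empty,
            hs.points, hs.rounds, hs.draws_le]
        · simpa using hs.table
        · exact hs.length_le.trans (Nat.le_succ t)
        · omega
      · have hmem : F.through L q ∈ O.subsys L := (O.mem_subsys L _).2 ⟨q, rfl⟩
        obtain ⟨i, hi, hiq⟩ := List.getElem_of_mem hmem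
        have := hlight i (by omega)
        rwa [List.getD_eq_getElem _ _ hi, hiq] at this

end Algorithm

end Search

/-! ### Potential argument for the rounds of a phase -/

section Rounds

variable {Q : Type u} {ι : Type v} [MeasurableSpace ι]

namespace RangeSpace

/-- The distribution of the ranges sampled in a round, where `P` are the points selected so far. -/
noncomputable def sampleDist (F : RangeSpace Q ι) (w₀ : Measure ι) (P : List Q) : Measure ι :=
  (F.halved w₀ P Set.univ)⁻¹ • F.halved w₀ P

/-- The total mass of the current weights. -/
noncomputable def weight (F : RangeSpace Q ι) (w₀ : Measure ι) (P : List Q) : ℝ :=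
  (F.halved w₀ P).real Set.univ

lemma weight_nil (F : RangeSpace Q ι) (w₀ : Measure ι) : F.weight w₀ [] = w₀.real Set.univ := by
  rw [weight, halved_nil]

variable [MeasurableSpace Q]

lemma halved_ne_zero {F : RangeSpace Q ι} (hF : F.MeasurableIncidence) (w₀ : Measure ι)
    [IsFiniteMeasure w₀] (hw : w₀ ≠ 0) (P : List Q) : F.halved w₀ P ≠ 0 := by
  intro h
  have := halved_univ_pos hF w₀ hw P
  rw [h] at this
  simp at this

lemma isProbabilityMeasure_sampleDist {F : RangeSpace Q ι} (hF : F.MeasurableIncidence)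
    (w₀ : Measure ι) [IsFiniteMeasure w₀] (hw : w₀ ≠ 0) (P : List Q) :
    IsProbabilityMeasure (F.sampleDist w₀ P) := by
  have : NeZero (F.halved w₀ P) := ⟨halved_ne_zero hF w₀ hw P⟩
  exact isProbabilityMeasureSMul

lemma weight_append {F : RangeSpace Q ι} (hF : F.MeasurableIncidence) (w₀ : Measure ι)
    [IsFiniteMeasure w₀] (hw : w₀ ≠ 0) (P : List Q) (q : Q) :
    F.weight w₀ (P ++ [q])
      = F.weight w₀ P * (1 - (F.sampleDist w₀ P).real (F.dual.range q) / 2) := by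
  rw [weight, halved_append hF]
  have hpos := halved_univ_pos hF w₀ hw P
  have : (F.sampleDist w₀ P).real (F.dual.range q)
      = (F.weight w₀ P)⁻¹ * (F.halved w₀ P).real (F.dual.range q) := by
    rw [sampleDist, measureReal_ennreal_smul_apply, ENNReal.toReal_inv]
    rfl
  rw [this, weight]
  field_simp

end RangeSpace

namespace Algorithm

section Potential

/-- The potential: each selected point should decrease the total weight. -/
noncomputable def potential (F : RangeSpace Q ι) (w₀ : Measure ι) (j : ℕ) (P : List Q) : ℝ :=
  F.weight w₀ P * (1 + 1 / (32 * 2 ^ j)) ^ P.length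

lemma potential_nonneg (F : RangeSpace Q ι) (w₀ : Measure ι) (j : ℕ) (P : List Q) :
    0 ≤ potential F w₀ j P := mul_nonneg measureReal_nonneg (by positivity)

variable [MeasurableSpace Q] {F : RangeSpace Q ι} {w₀ : Measure ι} [IsFiniteMeasure w₀]

lemma potential_append_le (hF : F.MeasurableIncidence) (hw : w₀ ≠ 0) (j : ℕ) (P : List Q) (q : Q) :
    potential F w₀ j (P ++ [q]) ≤ (1 + 1 / (32 * 2 ^ j)) * potential F w₀ j P := by
  have h0 : 0 ≤ F.weight w₀ P := measureReal_nonneg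
  have h1 : 0 ≤ (F.sampleDist w₀ P).real (F.dual.range q) := measureReal_nonneg
  rw [potential, potential, RangeSpace.weight_append hF w₀ hw, List.length_append,
    List.length_singleton, pow_succ]
  have h2 : F.weight w₀ P * (1 - (F.sampleDist w₀ P).real (F.dual.range q) / 2)
      ≤ F.weight w₀ P := by nlinarith
  calc _ ≤ F.weight w₀ P * ((1 + 1 / (32 * 2 ^ j)) ^ P.length * (1 + 1 / (32 * 2 ^ j))) := by
        gcongr
    _ = _ := by ring

lemma potential_append_le_of_deep (hF : F.MeasurableIncidence) (hw : w₀ ≠ 0) (j : ℕ) (P : List Q)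
    (q : Q) (hq : 1 ≤ 16 * 2 ^ j * (F.sampleDist w₀ P).real (F.dual.range q)) :
    potential F w₀ j (P ++ [q]) ≤ potential F w₀ j P := by
  have h0 : 0 ≤ F.weight w₀ P := measureReal_nonneg
  rw [potential, potential, RangeSpace.weight_append hF w₀ hw, List.length_append,
    List.length_singleton, pow_succ]
  set p := (F.sampleDist w₀ P).real (F.dual.range q)
  set x : ℝ := 1 / (32 * 2 ^ j) with hx
  have hx0 : 0 < x := by positivity
  have hxp : x ≤ p / 2 := by
    rw [hx, div_le_iff₀ (by positivity)]
    linarith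
  have : (1 - p / 2) * (1 + x) ≤ 1 := by nlinarith
  calc F.weight w₀ P * (1 - p / 2) * ((1 + x) ^ P.length * (1 + x))
      = F.weight w₀ P * (1 + x) ^ P.length * ((1 - p / 2) * (1 + x)) := by ring
    _ ≤ F.weight w₀ P * (1 + x) ^ P.length * 1 := by gcongr
    _ = _ := mul_one _

end Potential

variable [MeasurableSpace Q] [StandardBorelSpace Q] [StandardBorelSpace ι]
  {F : RangeSpace Q ι} {O : Oracles F} {d l e j t A B : ℕ} {P : List Q} {s : State Q ι}
  {w₀ : Measure ι} [IsFiniteMeasure w₀]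

/-- The effect of one round: with probability `31 / 32` the selected point, if any, is good. -/
lemma le_expect_round (hF : F.MeasurableIncidence) (hw : w₀ ≠ 0) (hd : 1 ≤ d) (hvc : F.vcDim ≤ d)
    {f : State Q ι → ℝ≥0∞} {a b : ℝ} (hba : b ≤ a)
    (hs : Config s d l e j P t A B) {g : ℕ} (hg1 : 1 ≤ g)
    (hg : ∀ L : List ι, L.length ≤ sampleSize d j → (O.subsys L).length ≤ g)
    (ha : ∀ s' P', Config s' d l e j P' (t + 1) (A + 11 * g) (B + sampleSize d j) →
      ((P' = P ∧ ¬ ∃ q, 1 ≤ 2 ^ j * (F.sampleDist w₀ P).real (F.dual.range q)) ∨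
        ∃ q, P' = P ++ [q] ∧ 1 ≤ 16 * 2 ^ j * (F.sampleDist w₀ P).real (F.dual.range q)) →
      ENNReal.ofReal a ≤ f s')
    (hb : ∀ s' P', Config s' d l e j P' (t + 1) (A + 11 * g) (B + sampleSize d j) →
      (P' = P ∨ ∃ q, P' = P ++ [q]) → ENNReal.ofReal b ≤ f s') :
    ENNReal.ofReal (31 / 32 * a + 1 / 32 * b) ≤ expect F w₀ O round f s := by
  have hprob := RangeSpace.isProbabilityMeasure_sampleDist hF w₀ hw P
  obtain ⟨G, hG, hGq, hG1, hG2⟩ := exists_good_samples hF hd hvc (F.sampleDist w₀ P) j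
  rw [round, expect_seq, expect_setReal, expect_seq]
  set s₁ := (s.setReal ((NExp.add (.const 3) (.numPts 1)).eval s)
    ((RExp.div (.load (.add (.const 2) (.numPts 1))) (.const 2)).eval s)).tick 1 with hs₁
  have hval : (RExp.div (.load (.add (.const 2) (.numPts 1))) (.const 2)).eval s
      = (1 / 2) ^ (P.length + 1) := by
    simp only [RExp.eval, NExp.eval, hs.points, hs.table _ le_rfl, pow_succ]
    push_cast
    ring
  have hreal : s₁.real = Function.update s.real (3 + P.length) ((1 / 2) ^ (P.length + 1)) := by
    simp only [hs₁, hval, State.tick, State.setReal, NExp.eval, hs.points]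
  have htab : ∀ k ≤ P.length + 1, s₁.real (2 + k) = (1 / 2) ^ k := by
    intro k hk
    rw [hreal]
    rcases Nat.le_succ_iff.1 hk with h | h
    · rw [Function.update_of_ne (by omega), hs.table k h]
    · subst h
      rw [show 2 + (P.length + 1) = 3 + P.length by ring, Function.update_self]
  have hc₁ : Config s₁ d l e j P t (A + 1) B :=
    { hs with
      table := fun k hk => htab k (by omega)
      steps_le := Nat.add_le_add_right hs.steps_le 1 }
  have h132 : (1 : ℝ) / 32 = 1 - 31 / 32 := by norm_num
  rw [h132]
  have hsel : ∀ (x : Fin (sampleSize d j) → ι) (w : ℝ),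
      (∀ s' P', Config s' d l e j P' (t + 1) (A + 11 * g) (B + sampleSize d j) →
      ((P' = P ∧ ∀ q, sampleCount x (F.dual.range q) < heavyCount d j) ∨
        ∃ q, P' = P ++ [q] ∧ heavyCount d j ≤ sampleCount x (F.dual.range q)) →
        ENNReal.ofReal w ≤ f s') →
      ENNReal.ofReal w ≤ expect F w₀ O select f
        (((s₁.setRgs 0 (List.ofFn x)).addDraws (sampleSize d j)).tick 1) := by
    intro x w hx
    have hrg : (((s₁.setRgs 0 (List.ofFn x)).addDraws (sampleSize d j)).tick 1).rgs 0
        = List.ofFn x := by simp [State.setRgs, State.addDraws, State.tick]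
    have hc₂ : Config (((s₁.setRgs 0 (List.ofFn x)).addDraws (sampleSize d j)).tick 1)
        d l e j P t (A + 2) (B + sampleSize d j) :=
      { hc₁ with
        steps_le := Nat.add_le_add_right hc₁.steps_le 1
        draws_le := Nat.add_le_add_right hc₁.draws_le _ }
    refine le_expect_select hc₂ (htab _ le_rfl) (g := g) ?_ ?_
    · rw [hrg]
      exact hg _ (by simp)
    · intro s' P' hc hP
      simp only [hrg, RangeSpace.length_through_ofFn] at hP
      exact hx s' P' (hc.mono (by omega) le_rfl) hP
  refine le_expect_sample F w₀ O _ s₁ 0 1 (.const 2) sampleExp (μ := F.halved w₀ P)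
    hc₁.sampleExp_eval ?_ (RangeSpace.halved_ne_zero hF w₀ hw P) hG hba hGq ?_ ?_
  · rw [hc₁.points]
    exact F.reweight_eq_halved w₀ P hc₁.table
  · intro x hx
    refine hsel x a fun s' P' hc hP => ha s' P' hc ?_
    rcases hP with ⟨rfl, hq⟩ | ⟨q, rfl, hq⟩
    · refine Or.inl ⟨rfl, fun h => ?_⟩
      obtain ⟨q, hq'⟩ := hG2 h x hx
      exact absurd (hq q) (not_lt.2 hq')
    · exact Or.inr ⟨q, rfl, hG1 x hx q hq⟩
  · intro x
    refine hsel x b fun s' P' hc hP => hb s' P' hc ?_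
    rcases hP with ⟨rfl, -⟩ | ⟨q, rfl, -⟩
    · exact Or.inl rfl
    · exact Or.inr ⟨q, rfl⟩

/-- The lower bound for the success probability when `k` rounds of a phase are left.  Here
`α` is one if rejections are charged and zero otherwise. -/
noncomputable def guarantee (F : RangeSpace Q ι) (w₀ : Measure ι) (l j : ℕ) (u c α : ℝ) (k : ℕ)
    (P : List Q) : ℝ :=
  u - c * potential F w₀ j P * (1 + 1 / (1024 * 2 ^ j)) ^ k
    - α * (2 / roundCount l j) * ((roundCount l j - k) - P.length + k / 32)

/-- The rounds of a phase. -/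
lemma le_loopExp_round (hF : F.MeasurableIncidence) (hw : w₀ ≠ 0) (hd : 1 ≤ d) (hvc : F.vcDim ≤ d)
    {f : State Q ι → ℝ≥0∞} {u c α : ℝ} (hc : 0 ≤ c) (hα0 : 0 ≤ α)
    (hα : α = 0 ∨ ∀ P, ∃ q, 1 ≤ 2 ^ j * (F.sampleDist w₀ P).real (F.dual.range q))
    {g : ℕ} (hg1 : 1 ≤ g)
    (hg : ∀ L : List ι, L.length ≤ sampleSize d j → (O.subsys L).length ≤ g) {A' B' : ℕ}
    (hf : ∀ s' P', Config s' d l e j P' (roundCount l j) A' B' →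
      ENNReal.ofReal (guarantee F w₀ l j u c α 0 P') ≤ f (s'.tick 1)) :
    ∀ (k : ℕ) {s : State Q ι} {P : List Q} {t A B : ℕ}, Config s d l e j P t A B →
      t + k = roundCount l j → A + 12 * g * k ≤ A' → B + sampleSize d j * k ≤ B' →
      ENNReal.ofReal (guarantee F w₀ l j u c α k P) ≤
        loopExp (fun t => BExp.eval F t (.ltN (.reg 9) roundsExp)) (expect F w₀ O round) f
          (k + 1) s := by
  intro k
  induction k with
  | zero =>
    intro s P t A B hs ht hA hB
    rw [loopExp_succ_of_neg]
    · have : t = roundCount l j := ht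
      subst this
      exact hf s P (hs.mono hA hB)
    · simp only [BExp.eval, hs.roundsExp_eval, NExp.eval, NExp.reg, hs.rounds]
      omega
  | succ k ih =>
    intro s P t A B hs ht hA hB
    rw [loopExp_succ_of_pos]
    swap
    · simp only [BExp.eval, hs.roundsExp_eval, NExp.eval, NExp.reg, hs.rounds]
      omega
    set T := roundCount l j with hT
    have hT0 : (0 : ℝ) < T := by
      have : 0 < roundCount l j := by unfold roundCount; positivity
      exact_mod_cast this
    set x : ℝ := 1 / (32 * 2 ^ j) with hx
    set γ : ℝ := 1 + 1 / (1024 * 2 ^ j) with hγ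
    have hγx : γ = 1 + x / 32 := by rw [hγ, hx]; field_simp; ring
    have hx0 : 0 < x := by positivity
    have hγ0 : 0 < γ := by positivity
    have hpot := potential_nonneg F w₀ j P
    have hβ : 0 ≤ α * (2 / T) := by positivity
    have hcγ : 0 ≤ c * γ ^ k := by positivity
    set Ψ := potential F w₀ j P
    -- The guarantee with `k` rounds left after a good round (`a`) and in the worst case (`b`). Its
    -- value with `k + 1` rounds left is exactly their mixture with weights `31 / 32` and `1 / 32`,
    -- because `γ = 1 + x / 32`; the last factor is the number of rounds without a selection so far
    -- plus `1 / 32` for each future round.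
    let a : ℝ := u - c * γ ^ k * Ψ - α * (2 / T) * ((T - k) - (P.length + 1) + k / 32)
    let b : ℝ := u - c * γ ^ k * ((1 + x) * Ψ) - α * (2 / T) * ((T - k) - P.length + k / 32)
    have hba : b ≤ a := by
      have h1 : Ψ ≤ (1 + x) * Ψ := by nlinarith
      have h2 := mul_le_mul_of_nonneg_left h1 hcγ
      simp only [a, b]
      nlinarith
    have hab : guarantee F w₀ l j u c α (k + 1) P = 31 / 32 * a + 1 / 32 * b := by
      simp only [guarantee, a, b, ← hγ, ← hT]
      rw [pow_succ, hγx]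
      push_cast
      ring
    rw [hab]
    have hstep : ∀ s' P', Config s' d l e j P' (t + 1) (A + 1 + 11 * g) (B + sampleSize d j) →
        ENNReal.ofReal (guarantee F w₀ l j u c α k P') ≤
          loopExp (fun t => BExp.eval F t (.ltN (.reg 9) roundsExp)) (expect F w₀ O round) f
            (k + 1) s' := fun s' P' hc' =>
      ih hc' (by omega) (by nlinarith) (by nlinarith)
    refine le_expect_round hF hw hd hvc hba (hs.tick 1) hg1 hg ?_ ?_
    · intro s' P' hc' hP'
      refine le_trans (ENNReal.ofReal_le_ofReal ?_) (hstep s' P' hc')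
      simp only [guarantee, ← hγ, ← hT]
      rcases hP' with ⟨rfl, hq⟩ | ⟨q, rfl, hq⟩
      · rcases hα with rfl | hα
        · simp only [a, zero_mul, sub_zero]
          exact le_of_eq (by ring)
        · exact absurd (hα P') hq
      · have h1 := potential_append_le_of_deep hF hw j P q hq
        have h2 := mul_le_mul_of_nonneg_left h1 hcγ
        simp only [a, List.length_append, List.length_singleton]
        push_cast
        linarith
    · intro s' P' hc' hP'
      refine le_trans (ENNReal.ofReal_le_ofReal ?_) (hstep s' P' hc')
      simp only [guarantee, ← hγ, ← hT]
      rcases hP' with rfl | ⟨q, rfl⟩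
      · have h1 : Ψ ≤ (1 + x) * Ψ := by nlinarith
        have h2 := mul_le_mul_of_nonneg_left h1 hcγ
        simp only [b]
        linarith
      · have h1 := potential_append_le hF hw j P q
        have h2 := mul_le_mul_of_nonneg_left h1 hcγ
        simp only [b, List.length_append, List.length_singleton]
        push_cast
        linarith

end Algorithm

end Rounds

/-! ### Drawing the output and accepting or rejecting a guess -/

section Output

lemma lintegral_uniformIndex {n m : ℕ} (h : (Fin m → Fin (n + 1)) → ℝ≥0∞) :
    ∫⁻ x, h x ∂(Measure.pi fun _ => uniformIndex n)
      = (∑ x, h x) / ((n + 1 : ℕ) : ℝ≥0∞) ^ m := by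
  have h1 : ∀ k, uniformIndex n {k} = ((n + 1 : ℕ) : ℝ≥0∞)⁻¹ := by
    intro k
    rw [uniformIndex, PMF.toMeasure_apply_singleton _ _ (measurableSet_singleton k)]
    simp
  rw [lintegral_fintype, ENNReal.div_eq_inv_mul, Finset.mul_sum]
  refine Finset.sum_congr rfl fun x _ => ?_
  rw [Measure.pi_singleton]
  simp only [h1, Finset.prod_const, Finset.card_univ, Fintype.card_fin]
  rw [mul_comm, ENNReal.inv_pow]

namespace Algorithm

variable {Q : Type u} {ι : Type v} [MeasurableSpace ι]
  {F : RangeSpace Q ι} {O : Oracles F} {d l e j t A B : ℕ} {P : List Q} {s : State Q ι}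
  {w₀ : Measure ι}

/-- Unfolds successive uniform choices into one average over all index vectors, the form in which
the net estimate for product measures applies. -/
lemma le_loopExp_net {n S B A' : ℕ} (p : Fin (n + 1) → Q) {f : State Q ι → ℝ≥0∞}
    (h : List Q → ℝ≥0∞)
    (hf : ∀ s' : State Q ι, s'.output.length = S → s'.steps ≤ A' → s'.draws ≤ B →
      h s'.output ≤ f (s'.tick 1)) :
    ∀ (m : ℕ) {s : State Q ι} {A : ℕ}, s.nat 11 + m = S → netExp.eval s = S →
      s.output.length = s.nat 11 → s.pts 1 = List.ofFn p → s.steps ≤ A → A + 4 * m ≤ A' →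
      s.draws ≤ B →
      (∑ x : Fin m → Fin (n + 1), h (s.output ++ List.ofFn fun k => p (x k)))
          / ((n + 1 : ℕ) : ℝ≥0∞) ^ m ≤
        loopExp (fun t => BExp.eval F t (.ltN (.reg 11) netExp))
          (expect F w₀ O (.seq (.rand (.const 12) (.sub (.numPts 1) (.const 1)))
            (.seq (.push 0 1 (.reg 12)) (.setNat (.const 11) (.add (.reg 11) (.const 1))))))
          f (m + 1) s := by
  intro m
  induction m with
  | zero =>
    intro s A hm hS hlen hp hA hA' hB
    rw [loopExp_succ_of_neg]
    · simpa using hf s (by omega) (by omega) hB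
    · simp only [BExp.eval, hS, NExp.eval, NExp.reg]
      omega
  | succ m ih =>
    intro s A hm hS hlen hp hA hA' hB
    rw [loopExp_succ_of_pos]
    swap
    · simp only [BExp.eval, hS, NExp.eval, NExp.reg]
      omega
    have hn : (NExp.sub (.numPts 1) (.const 1)).eval (s.tick 1) = n := by
      simp [NExp.eval, State.tick, hp]
    rw [expect_seq, expect, hn]
    rw [pow_succ, ENNReal.div_eq_inv_mul, ENNReal.div_eq_inv_mul,
      ENNReal.mul_inv (by simp) (by simp), mul_comm (_ ^ m)⁻¹, mul_assoc]
    gcongr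
    rw [Finset.sum_range, ← ENNReal.div_eq_inv_mul,
      ← (Fin.consEquiv fun _ : Fin (m + 1) => Fin (n + 1)).sum_comp, Fintype.sum_prod_type,
      ENNReal.div_eq_inv_mul, Finset.mul_sum]
    refine Finset.sum_le_sum fun k _ => ?_
    rw [expect_seq, expect_push, expect_setNat, ← ENNReal.div_eq_inv_mul]
    set s' := ((((((s.tick 1).setNat ((NExp.const 12).eval (s.tick 1)) k).tick 1).setPts 0 _).tick
      1).setNat _ _).tick 1 with hs'
    have hout : s'.output = s.output ++ [p k] := by
      simp [hs', State.output, State.setPts, State.tick, State.setNat, NExp.eval, NExp.reg, hp,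
        -List.ofFn_succ]
      exact k.is_le
    have hnat : s'.nat 11 = s.nat 11 + 1 := by
      simp [hs', State.setPts, State.tick, State.setNat, NExp.eval, NExp.reg]
    have key := ih (s := s') (A := A + 4) (by omega)
      (by rw [← hS]; simp [hs', netExp, NExp.eval, NExp.reg, State.setPts, State.tick, State.setNat])
      (by rw [hout, hnat, List.length_append, List.length_singleton, hlen])
      (by simp [hs', State.setPts, State.tick, State.setNat, hp])
      (by simp only [hs', State.setPts, State.tick, State.setNat]; omega) (by omega) hB
    refine le_trans (le_of_eq ?_) key
    congr 1
    refine Finset.sum_congr rfl fun x _ => ?_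
    rw [hout, List.append_assoc]
    congr 2
    rw [List.ofFn_succ]
    rfl

lemma le_expect_net (hs : Config s d l e j P t A B) (hP : P ≠ []) {f : State Q ι → ℝ≥0∞}
    (hd : 1 ≤ d) (hvc : F.vcDim ≤ d) (he : d ≤ 2 ^ e)
    (hf : ∀ s' : State Q ι, s'.output.length = netSize d e j →
      (∀ i, P.length ≤ 256 * 2 ^ j * F.hits P i → ∃ q ∈ s'.output, q ∈ F.range i) →
      s'.steps ≤ A + 4 * netSize d e j + 2 → s'.draws ≤ B → 1 ≤ f s') :
    ENNReal.ofReal (1 - (2 ^ (j + 5))⁻¹) ≤ expect F w₀ O net f s := by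
  classical
  obtain ⟨n, hn⟩ : ∃ n, P.length = n + 1 :=
    Nat.exists_eq_succ_of_ne_zero (by simpa using hP)
  let p : Fin (n + 1) → Q := fun k => P.get (k.cast hn.symm)
  have hpP : P = List.ofFn p := by
    conv_lhs => rw [← List.ofFn_get P]
    rw [List.ofFn_congr hn]
  let h : List Q → ℝ≥0∞ := fun L =>
    if ∀ i, P.length ≤ 256 * 2 ^ j * F.hits P i → ∃ q ∈ L, q ∈ F.range i then 1 else 0
  rw [net, expect_seq, expect_setNat]
  refine le_trans ?_ (loopExp_le_expect F w₀ O f _ _ _ (netSize d e j + 1))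
  have hout : (((s.setNat ((NExp.const 11).eval s) ((NExp.const 0).eval s)).tick 1)).output = [] :=
    hs.empty
  have hnat : (((s.setNat ((NExp.const 11).eval s) ((NExp.const 0).eval s)).tick 1)).nat 11 = 0 := by
    simp [State.setNat, State.tick, NExp.eval]
  have key := le_loopExp_net (F := F) (O := O) (w₀ := w₀) (S := netSize d e j) (B := B)
    (A' := A + 4 * netSize d e j + 1) p (f := f) h
    (fun s' h1 h2 h3 => by
      by_cases hx : ∀ i, P.length ≤ 256 * 2 ^ j * F.hits P i → ∃ q ∈ s'.output, q ∈ F.range i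
      · simp only [h, if_pos hx]
        exact hf _ h1 hx (Nat.add_le_add_right h2 1) h3
      · simp only [h, if_neg hx]; exact bot_le) (netSize d e j)
    (s := ((s.setNat ((NExp.const 11).eval s) ((NExp.const 0).eval s)).tick 1)) (A := A + 1)
    (by rw [hnat, zero_add])
    (by rw [← hs.netExp_eval]; simp [netExp, NExp.eval, NExp.reg, State.tick, State.setNat])
    (by rw [hout, hnat]; rfl) (hs.points.trans hpP) (Nat.add_le_add_right hs.steps_le 1) (by omega)
    hs.draws_le
  refine le_trans ?_ key
  rw [← lintegral_uniformIndex, hout]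
  set M := Measure.pi fun _ : Fin (netSize d e j) => uniformIndex n
  let bad : Set (Fin (netSize d e j) → Fin (n + 1)) :=
    {x | ∃ i, n + 1 ≤ 256 * 2 ^ j * sampleCount p (F.range i) ∧ ∀ k, p (x k) ∉ F.range i}
  have hbad : M bad ≤ (2 ^ (j + 5))⁻¹ := measure_not_net_le hd hvc he j n p
  have hbadm : MeasurableSet bad := (Set.toFinite _).measurableSet
  have hhits : ∀ i, F.hits P i = sampleCount p (F.range i) := by
    intro i
    rw [← countP_ofFn, ← hpP, RangeSpace.hits]
  calc ENNReal.ofReal (1 - (2 ^ (j + 5))⁻¹) = 1 - (2 ^ (j + 5))⁻¹ := by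
        rw [ENNReal.ofReal_sub _ (by positivity), ENNReal.ofReal_one,
          ENNReal.ofReal_inv_of_pos (by positivity), ENNReal.ofReal_pow (by norm_num)]
        simp
    _ ≤ 1 - M bad := tsub_le_tsub_left hbad 1
    _ = M badᶜ := (prob_compl_eq_one_sub hbadm).symm
    _ = ∫⁻ x, badᶜ.indicator 1 x ∂M := (lintegral_indicator_one hbadm.compl).symm
    _ ≤ _ := by
        refine lintegral_mono fun x => ?_
        by_cases hx : x ∈ badᶜ
        swap
        · rw [Set.indicator_of_notMem hx]
          exact bot_le
        rw [Set.indicator_of_mem hx]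
        have : ∀ i, P.length ≤ 256 * 2 ^ j * F.hits P i →
            ∃ q ∈ [] ++ List.ofFn fun k => p (x k), q ∈ F.range i := by
          intro i hi
          by_contra! hno
          refine hx ⟨i, ?_, fun k => hno _ ?_⟩
          · rwa [hn, hhits] at hi
          · rw [List.nil_append, List.mem_ofFn]
            exact ⟨k, rfl⟩
        simp only [h, if_pos this, Pi.one_apply, le_refl]

lemma le_expect_decision_of_reject {f : State Q ι → ℝ≥0∞} {v : ℝ≥0∞}
    (hs : Config s d l e j P (roundCount l j) A B) (hP : P.length + P.length < roundCount l j)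
    (hf : ∀ s' : State Q ι, Config s' d l e (j + 1) P (roundCount l j) (A + 3) B → v ≤ f s') :
    v ≤ expect F w₀ O decision f s := by
  rw [decision, expect_branch_of_pos]
  swap
  · simpa only [BExp.eval, hs.roundsExp_eval, NExp.eval, hs.points] using hP
  rw [expect_seq, expect_setNat, expect_setNat]
  refine hf _ ?_
  have := hs.steps_le
  constructor <;>
    try simp [State.tick, State.setNat, NExp.eval, NExp.reg,
      hs.dim, hs.pow, hs.logDelta, hs.logDim, hs.guess, hs.logGuess, hs.running, hs.empty,
      hs.points, hs.rounds, hs.draws_le]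
  · ring
  · simpa using hs.table
  · exact hs.length_le
  · omega

variable [MeasurableSpace Q]

variable [IsFiniteMeasure w₀]

/-- A range hit more than `l + j + 8` times contains a `1 / (256 * 2 ^ j)` fraction of `P`, since
`|P|` is at most the number of rounds. So the net misses only light ranges, except with probability
`2 ^ (-(j + 5))`. -/
lemma le_expect_decision_of_accept (hF : F.MeasurableIncidence) {δ : ℝ} {f : State Q ι → ℝ≥0∞}
    (hs : Config s d l e j P (roundCount l j) A B) (hP : roundCount l j ≤ P.length + P.length)
    (hlight : w₀.real {i | F.hits P i ≤ l + j + 8} ≤ δ * w₀.real Set.univ)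
    (hd : 1 ≤ d) (hvc : F.vcDim ≤ d) (he : d ≤ 2 ^ e)
    (hf : ∀ s' : State Q ι, s'.nat 13 = 1 → s'.output.length = netSize d e j →
      (1 - δ) * w₀.real Set.univ ≤ w₀.real (F.hitBy s'.output) →
      s'.steps ≤ A + 4 * netSize d e j + 4 → s'.draws ≤ B → 1 ≤ f s') :
    ENNReal.ofReal (1 - (2 ^ (j + 5))⁻¹) ≤ expect F w₀ O decision f s := by
  have hT : 0 < roundCount l j := by unfold roundCount; positivity
  have hP0 : P ≠ [] := by
    rintro rfl
    simp at hP
    omega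
  rw [decision, expect_branch_of_neg]
  swap
  · simp only [BExp.eval, hs.roundsExp_eval, NExp.eval, hs.points]
    omega
  rw [expect_seq]
  refine le_expect_net (hs.tick 1) hP0 hd hvc he fun s' h1 h2 h3 h4 => ?_
  rw [expect_setNat]
  refine hf _ (by simp [State.setNat, State.tick, NExp.eval]) h1 ?_
    (by simp only [State.setNat, State.tick]; omega) h4
  change _ ≤ w₀.real (F.hitBy s'.output)
  have hm : MeasurableSet {i | F.hits P i ≤ l + j + 8} := RangeSpace.measurable_hits hF P measurableSet_Iic
  have hsub : {i | F.hits P i ≤ l + j + 8}ᶜ ⊆ F.hitBy s'.output := by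
    intro i hi
    have hi' : l + j + 8 < F.hits P i := not_le.1 hi
    refine h2 i (hs.length_le.trans ?_)
    unfold roundCount
    gcongr
  have h5 := measureReal_mono (μ := w₀) hsub
  rw [measureReal_compl hm] at h5
  linarith

end Algorithm

end Output

/-! ### Success probability and cost of the phases -/

section Phases

namespace Algorithm

lemma roundCount_pos (l j : ℕ) : 0 < roundCount l j := by unfold roundCount; positivity

/-- The expected growth of the potential caused by bad rounds: every `256 * 2 ^ j` rounds cost at
most a factor `exp (1 / 4) ≤ 2`. -/
lemma growth_factor_le (l j : ℕ) :
    (1 + 1 / (1024 * 2 ^ j) : ℝ) ^ roundCount l j ≤ 2 ^ (l + j + 8) := by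
  rw [roundCount, pow_mul]
  gcongr
  have h1 : (1 + 1 / (1024 * 2 ^ j) : ℝ) ≤ Real.exp (1 / (1024 * 2 ^ j)) := by
    rw [add_comm]; exact Real.add_one_le_exp _
  calc (1 + 1 / (1024 * 2 ^ j) : ℝ) ^ (256 * 2 ^ j)
      ≤ Real.exp (1 / (1024 * 2 ^ j)) ^ (256 * 2 ^ j) := by gcongr
    _ = Real.exp (1 / 4) := by
        rw [← Real.exp_nat_mul]
        congr 1
        push_cast
        field_simp
        norm_num
    _ ≤ Real.exp (Real.log 2) := by
        rw [Real.exp_le_exp]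
        have := Real.log_two_gt_d9
        linarith
    _ = 2 := Real.exp_log two_pos

/-- By Bernoulli, every `32 * 2 ^ j` selected points gain a factor two, and half of the rounds
contain `4 * (l + j + 8)` such blocks. -/
lemma pow_le_reward {l j n : ℕ} (hn : roundCount l j ≤ n + n) :
    (2 : ℝ) ^ (4 * (l + j + 8)) ≤ (1 + 1 / (32 * 2 ^ j)) ^ n := by
  have h1 : (1 : ℝ) ≤ 1 + 1 / (32 * 2 ^ j) := by
    have : (0 : ℝ) ≤ 1 / (32 * 2 ^ j) := by positivity
    linarith
  have h2 : (2 : ℝ) ≤ (1 + 1 / (32 * 2 ^ j)) ^ (32 * 2 ^ j) := by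
    have := one_add_mul_le_pow (a := (1 : ℝ) / (32 * 2 ^ j))
      (by have : (0 : ℝ) ≤ 1 / (32 * 2 ^ j) := by positivity
          linarith) (32 * 2 ^ j)
    refine le_trans (le_of_eq ?_) this
    push_cast
    field_simp
    norm_num
  calc (2 : ℝ) ^ (4 * (l + j + 8)) ≤ ((1 + 1 / (32 * 2 ^ j)) ^ (32 * 2 ^ j)) ^ (4 * (l + j + 8)) := by
        gcongr
    _ = (1 + 1 / (32 * 2 ^ j)) ^ (32 * 2 ^ j * (4 * (l + j + 8))) := (pow_mul _ _ _).symm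
    _ ≤ _ := by
        refine pow_le_pow_right₀ h1 ?_
        have : roundCount l j = 2 * (32 * 2 ^ j * (4 * (l + j + 8))) := by unfold roundCount; ring
        omega

variable {Q : Type u} {ι : Type v} [MeasurableSpace ι]
  {F : RangeSpace Q ι} {O : Oracles F} {d l e j t A B : ℕ} {P : List Q} {s : State Q ι}
  {w₀ : Measure ι} [MeasurableSpace Q] [IsFiniteMeasure w₀]

/-- The factor that turns the potential into a bound for the failure probability. -/
noncomputable def failureScale (w₀ : Measure ι) (l j : ℕ) : ℝ :=
  (2 ^ (j + 5))⁻¹ / (w₀.real Set.univ * (1 + 1 / (1024 * 2 ^ j)) ^ roundCount l j)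

/-- With `m = l + j + 8`, the reward `2 ^ (4 * m)` pays for four factors: `2 ^ m` for the growth, `2
^ m` for passing from weights to light ranges, and `2 ^ (2 * m)` for the Markov factor `2 ^ (j + 5)`
and for `1 / δ`. -/
lemma light_le_of_potential_lt (hF : F.MeasurableIncidence) (hw : w₀ ≠ 0) {δ : ℝ}
    (hl : 1 ≤ 2 ^ l * δ) (hP : roundCount l j ≤ P.length + P.length)
    (hpot : failureScale w₀ l j * potential F w₀ j P < 1) :
    w₀.real {i | F.hits P i ≤ l + j + 8} ≤ δ * w₀.real Set.univ := by
  have hW : 0 < w₀.real Set.univ := by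
    have := RangeSpace.halved_univ_pos hF w₀ hw []
    rwa [RangeSpace.halved_nil] at this
  refine (RangeSpace.light_measure_le hF w₀ P _).trans ?_
  change 2 ^ (l + j + 8) * F.weight w₀ P ≤ _
  have hΦ : 0 ≤ F.weight w₀ P := measureReal_nonneg
  have h1 := growth_factor_le l j
  have h2 := pow_le_reward hP
  set γT := (1 + 1 / (1024 * 2 ^ j) : ℝ) ^ roundCount l j with hγ
  have hγ0 : 0 < γT := by positivity
  set W := w₀.real Set.univ
  have h3 : potential F w₀ j P < 2 ^ (j + 5) * (W * γT) := by
    rw [failureScale, ← hγ, div_mul_eq_mul_div, div_lt_one (by positivity),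
      inv_mul_lt_iff₀ (by positivity)] at hpot
    exact hpot
  set m := l + j + 8 with hm
  have h4 : F.weight w₀ P * 2 ^ (4 * m) ≤ 2 ^ (j + 5) * (W * 2 ^ m) := by
    calc F.weight w₀ P * 2 ^ (4 * m) ≤ potential F w₀ j P := by
          unfold potential; gcongr
      _ ≤ 2 ^ (j + 5) * (W * γT) := h3.le
      _ ≤ _ := by gcongr
  have h5 : (2 : ℝ) ^ (j + 5) * 2 ^ l ≤ 2 ^ (2 * m) := by
    rw [← pow_add]
    exact pow_le_pow_right₀ (by norm_num) (by omega)
  have hδ : 0 < δ := by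
    by_contra! h
    have := mul_nonpos_of_nonneg_of_nonpos (by positivity : (0 : ℝ) ≤ 2 ^ l) h
    linarith
  have h6 : (2 : ℝ) ^ (j + 5) ≤ δ * 2 ^ (2 * m) := by
    calc (2 : ℝ) ^ (j + 5) ≤ 2 ^ (j + 5) * (2 ^ l * δ) :=
          le_mul_of_one_le_right (by positivity) hl
      _ = δ * (2 ^ (j + 5) * 2 ^ l) := by ring
      _ ≤ _ := by gcongr
  have h7 : 2 ^ m * F.weight w₀ P * 2 ^ (3 * m) ≤ δ * W * 2 ^ (3 * m) := by
    calc 2 ^ m * F.weight w₀ P * 2 ^ (3 * m) = F.weight w₀ P * 2 ^ (4 * m) := by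
          rw [show 4 * m = m + 3 * m by ring, pow_add]; ring
      _ ≤ 2 ^ (j + 5) * (W * 2 ^ m) := h4
      _ ≤ (δ * 2 ^ (2 * m)) * (W * 2 ^ m) := by gcongr
      _ = _ := by rw [show 3 * m = 2 * m + m by ring, pow_add]; ring
  exact le_of_mul_le_mul_right h7 (by positivity)

variable [StandardBorelSpace Q] [StandardBorelSpace ι]

/-- One phase.  Rejecting the guess is a failure if `α` is one. -/
lemma le_expect_phase (hF : F.MeasurableIncidence) (hw : w₀ ≠ 0) (hd : 1 ≤ d) (hvc : F.vcDim ≤ d)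
    (he : d ≤ 2 ^ e) {δ : ℝ} (hl : 1 ≤ 2 ^ l * δ) {f : State Q ι → ℝ≥0∞} {u α : ℝ}
    {g : ℕ} (hg1 : 1 ≤ g)
    (hg : ∀ L : List ι, L.length ≤ sampleSize d j → (O.subsys L).length ≤ g)
    (hs : Config s d l e j P t A B) (hu : u ≤ 1 - (2 ^ (j + 5))⁻¹)
    (hacc : ∀ s' : State Q ι, s'.nat 13 = 1 → s'.output.length = netSize d e j →
      (1 - δ) * w₀.real Set.univ ≤ w₀.real (F.hitBy s'.output) →
      s'.steps ≤ A + 12 * g * roundCount l j + 4 * netSize d e j + 7 →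
      s'.draws ≤ B + sampleSize d j * roundCount l j → 1 ≤ f s')
    (hα : (α = 0 ∧ ∀ (s' : State Q ι) P', Config s' d l e (j + 1) P' (roundCount l j)
        (A + 12 * g * roundCount l j + 6) (B + sampleSize d j * roundCount l j) →
        ENNReal.ofReal u ≤ f s') ∨
      (α = 1 ∧ ∀ P, ∃ q, 1 ≤ 2 ^ j * (F.sampleDist w₀ P).real (F.dual.range q))) :
    ENNReal.ofReal (u - (2 ^ (j + 5))⁻¹ - α / 16) ≤ expect F w₀ O phase f s := by
  have hW : 0 < w₀.real Set.univ := by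
    have := RangeSpace.halved_univ_pos hF w₀ hw []
    rwa [RangeSpace.halved_nil] at this
  have hT : (0 : ℝ) < roundCount l j := by exact_mod_cast roundCount_pos l j
  have hc : 0 ≤ failureScale w₀ l j := by unfold failureScale; positivity
  have hα0 : 0 ≤ α := by rcases hα with ⟨rfl, -⟩ | ⟨rfl, -⟩ <;> norm_num
  -- `failureScale` is normalized so that the initial potential costs exactly `2 ^ (-(j + 5))`; the
  -- expected rejection charge is `(2 / T) * (T / 32) = 1 / 16`.
  have hstart : guarantee F w₀ l j u (failureScale w₀ l j) α (roundCount l j) []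
      = u - (2 ^ (j + 5))⁻¹ - α / 16 := by
    simp only [guarantee, potential, RangeSpace.weight_nil, failureScale, List.length_nil, pow_zero,
      mul_one]
    push_cast
    field_simp
    ring
  rw [← hstart, phase, expect_seq, expect_clear, expect_seq, expect_setNat, expect_seq]
  refine le_trans ?_ (loopExp_le_expect F w₀ O _ _ _ _ (roundCount l j + 1))
  refine le_loopExp_round hF hw hd hvc hc hα0 ?_ hg1 hg (t := 0) (A := A + 2) (B := B) (d := d) (e := e)
    (A' := A + 2 + 12 * g * roundCount l j) (B' := B + sampleSize d j * roundCount l j)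
    ?_ (roundCount l j) ?_ (zero_add _) le_rfl le_rfl
  · rcases hα with ⟨h, -⟩ | ⟨-, h⟩
    · exact Or.inl h
    · exact Or.inr h
  · intro s' P' hs'
    have hpot := potential_nonneg F w₀ j P'
    have hlen : (P'.length : ℝ) ≤ roundCount l j := by exact_mod_cast hs'.length_le
    have hgu : guarantee F w₀ l j u (failureScale w₀ l j) α 0 P'
        = u - failureScale w₀ l j * potential F w₀ j P'
          - α * (2 / roundCount l j) * (roundCount l j - P'.length) := by
      simp only [guarantee]
      push_cast
      ring
    have hβ : 0 ≤ α * (2 / roundCount l j) * (roundCount l j - P'.length) :=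
      mul_nonneg (by positivity) (by linarith)
    have hcp := mul_nonneg hc hpot
    by_cases hP : roundCount l j ≤ P'.length + P'.length
    · by_cases hlt : failureScale w₀ l j * potential F w₀ j P' < 1
      · refine le_trans (ENNReal.ofReal_le_ofReal ?_)
          (le_expect_decision_of_accept hF (hs'.tick 1) hP
            (light_le_of_potential_lt hF hw hl hP hlt) hd hvc he
            fun s'' h1 h2 h3 h4 h5 => hacc s'' h1 h2 h3 (by omega) h5)
        rw [hgu]
        linarith
      -- Markov's inequality in backward form: where the potential is too large the guarantee is
      -- nonpositive, so nothing has to be shown. The rejection case with `α = 1` below is the same.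
      · have h0 : guarantee F w₀ l j u (failureScale w₀ l j) α 0 P' ≤ 0 := by
          have : (0 : ℝ) ≤ (2 ^ (j + 5))⁻¹ := by positivity
          rw [hgu]
          linarith
        rw [ENNReal.ofReal_of_nonpos h0]
        exact bot_le
    · rcases hα with ⟨rfl, hrej⟩ | ⟨rfl, -⟩
      · refine le_trans (ENNReal.ofReal_le_ofReal ?_)
          (le_expect_decision_of_reject (hs'.tick 1) (by omega)
            fun s'' h => hrej s'' P' (h.mono (by omega) le_rfl))
        rw [hgu]
        linarith
      · have h0 : guarantee F w₀ l j u (failureScale w₀ l j) 1 0 P' ≤ 0 := by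
          have h1 : (2 * P'.length : ℝ) ≤ roundCount l j := by
            have : 2 * P'.length ≤ roundCount l j := by omega
            exact_mod_cast this
          have h2 : 1 ≤ 1 * (2 / (roundCount l j : ℝ)) * (roundCount l j - P'.length) := by
            rw [one_mul, div_mul_eq_mul_div, le_div_iff₀ hT]
            linarith
          have : (0 : ℝ) ≤ (2 ^ (j + 5))⁻¹ := by positivity
          rw [hgu]
          linarith
        rw [ENNReal.ofReal_of_nonpos h0]
        exact bot_le
  · constructor <;>
      try simp [State.tick, State.setNat, State.setPts, NExp.eval,
        hs.dim, hs.pow, hs.logDelta, hs.logDim, hs.guess, hs.logGuess, hs.running, hs.empty,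
        hs.draws_le]
    · simpa using hs.table 0 (by simp)
    · exact hs.steps_le

/-- The success probability from phase `j` on. -/
noncomputable def phaseGuarantee (j : ℕ) : ℝ := 1 - 1 / 16 - 1 / 8 * (2 ^ j)⁻¹

/-- All phases, where `J` is the last one that is needed. -/
lemma le_loopExp_phase (hF : F.MeasurableIncidence) (hw : w₀ ≠ 0) (hd : 1 ≤ d) (hvc : F.vcDim ≤ d)
    (he : d ≤ 2 ^ e) {δ : ℝ} (hl : 1 ≤ 2 ^ l * δ) {f : State Q ι → ℝ≥0∞} {J A₀ X Y : ℕ}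
    {g : ℕ} (hg1 : 1 ≤ g)
    (hg : ∀ L : List ι, L.length ≤ sampleSize d J → (O.subsys L).length ≤ g)
    (hX : 12 * g * (256 * (l + J + 8)) + 9 ≤ X) (hY : sampleSize d J * (256 * (l + J + 8)) ≤ Y)
    (hdeep : ∀ P, ∃ q, 1 ≤ 2 ^ J * (F.sampleDist w₀ P).real (F.dual.range q))
    (hf : ∀ s' : State Q ι, ∀ j ≤ J, s'.output.length = netSize d e j →
      (1 - δ) * w₀.real Set.univ ≤ w₀.real (F.hitBy s'.output) →
      s'.steps ≤ A₀ + 2 ^ (J + 1) * X + 4 * netSize d e J →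
      s'.draws ≤ 2 ^ (J + 1) * Y → 1 ≤ f s') :
    ∀ (n j : ℕ) {s : State Q ι} {P : List Q} {t : ℕ}, j + n = J →
      Config s d l e j P t (A₀ + 2 ^ j * X) (2 ^ j * Y) →
      ENNReal.ofReal (phaseGuarantee j) ≤
        loopExp (fun t => BExp.eval F t (.ltN (.reg 13) (.const 1))) (expect F w₀ O phase) f
          (n + 2) s := by
  have hsz : ∀ j ≤ J, sampleSize d j ≤ sampleSize d J := fun j hj => by
    unfold sampleSize; gcongr; norm_num
  have hnet : ∀ j ≤ J, netSize d e j ≤ netSize d e J := fun j hj => by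
    unfold netSize; gcongr; norm_num
  have hR : ∀ j ≤ J, roundCount l j ≤ 2 ^ j * (256 * (l + J + 8)) := fun j hj => by
    unfold roundCount
    calc 256 * 2 ^ j * (l + j + 8) = 2 ^ j * (256 * (l + j + 8)) := by ring
      _ ≤ _ := by gcongr
  -- Phase `j` costs at most `2 ^ j * X`, so a budget `A₀ + 2 ^ j * X` at its start becomes `A₀ + 2
  -- ^ (j + 1) * X` at its end: the phase costs grow geometrically. Draws are budgeted likewise.
  have hsteps : ∀ j ≤ J, 12 * g * roundCount l j + 9 ≤ 2 ^ j * X := fun j hj => by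
    have h1 : 1 ≤ 2 ^ j := Nat.one_le_two_pow
    calc 12 * g * roundCount l j + 9 ≤ 12 * g * (2 ^ j * (256 * (l + J + 8))) + 2 ^ j * 9 := by
          gcongr
          · exact hR j hj
          · omega
      _ = 2 ^ j * (12 * g * (256 * (l + J + 8)) + 9) := by ring
      _ ≤ _ := by gcongr
  have hdraws : ∀ j ≤ J, sampleSize d j * roundCount l j ≤ 2 ^ j * Y := fun j hj => by
    calc sampleSize d j * roundCount l j ≤ sampleSize d J * (2 ^ j * (256 * (l + J + 8))) := by
          gcongr
          · exact hsz j hj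
          · exact hR j hj
      _ = 2 ^ j * (sampleSize d J * (256 * (l + J + 8))) := by ring
      _ ≤ _ := by gcongr
  have hacc : ∀ j ≤ J, ∀ (m : ℕ) (s' : State Q ι), s'.nat 13 = 1 →
      s'.output.length = netSize d e j →
      (1 - δ) * w₀.real Set.univ ≤ w₀.real (F.hitBy s'.output) →
      s'.steps ≤ A₀ + 2 ^ j * X + 1 + 12 * g * roundCount l j + 4 * netSize d e j + 7 →
      s'.draws ≤ 2 ^ j * Y + sampleSize d j * roundCount l j →
      1 ≤ loopExp (fun t => BExp.eval F t (.ltN (.reg 13) (.const 1))) (expect F w₀ O phase) f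
          (m + 1) s' := by
    intro j hj m s' h1 h2 h3 h4 h5
    have hpow : 2 ^ (j + 1) ≤ 2 ^ (J + 1) := Nat.pow_le_pow_right (by norm_num) (by omega)
    have hXJ := Nat.mul_le_mul_right X hpow
    have hYJ := Nat.mul_le_mul_right Y hpow
    have hs := hsteps j hj
    have hd := hdraws j hj
    have hn := hnet j hj
    have e1 : 2 ^ (j + 1) * X = 2 ^ j * X + 2 ^ j * X := by ring
    have e2 : 2 ^ (j + 1) * Y = 2 ^ j * Y + 2 ^ j * Y := by ring
    rw [loopExp_succ_of_neg]
    · refine hf (s'.tick 1) j hj h2 h3 ?_ ?_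
      · simp only [State.tick]
        omega
      · simp only [State.tick]
        omega
    · simp only [BExp.eval, NExp.eval, NExp.reg, h1]
      omega
  have hrunning : ∀ {s : State Q ι} {j : ℕ} {P : List Q} {t A B : ℕ}, Config s d l e j P t A B →
      BExp.eval F s (.ltN (.reg 13) (.const 1)) := by
    intro s j P t A B hs
    simp only [BExp.eval, NExp.eval, NExp.reg, hs.running]
    omega
  have hexp : ∀ j : ℕ, ((2 : ℝ) ^ (j + 5))⁻¹ = (2 ^ j)⁻¹ / 32 := by
    intro j
    rw [pow_add, mul_inv]
    norm_num
    ring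
  intro n
  induction n with
  | zero =>
    intro j s P t hj hs
    obtain rfl : j = J := hj
    rw [loopExp_succ_of_pos (hrunning hs)]
    refine le_trans (ENNReal.ofReal_le_ofReal ?_) (le_expect_phase hF hw hd hvc he hl hg1
      hg (hs.tick 1) (le_refl (1 - (2 ^ (j + 5))⁻¹)) (hacc j le_rfl 0) (Or.inr ⟨rfl, hdeep⟩))
    have : (0 : ℝ) < (2 ^ j)⁻¹ := by positivity
    rw [phaseGuarantee, hexp]
    linarith
  | succ n ih =>
    intro j s P t hj hs
    rw [loopExp_succ_of_pos (hrunning hs)]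
    -- Before the last phase rejection is free. The value `u` is the next guarantee minus the
    -- failure probability of the net, which also keeps it below the acceptance probability; the
    -- potential accounts for the second loss of `2 ^ (-(j + 5))`.
    refine le_trans (ENNReal.ofReal_le_ofReal ?_) (le_expect_phase hF hw hd hvc he hl hg1
      (fun L hL => hg L (hL.trans (hsz j (by omega)))) (hs.tick 1)
      (u := phaseGuarantee (j + 1) - (2 ^ (j + 5))⁻¹) (α := 0) ?_ (hacc j (by omega) (n + 1))
      (Or.inl ⟨rfl, fun s' P' hs' => ?_⟩))
    · rw [phaseGuarantee, phaseGuarantee, hexp, pow_succ, mul_inv]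
      linarith
    · have : (0 : ℝ) < (2 ^ (j + 1))⁻¹ := by positivity
      rw [phaseGuarantee]
      linarith
    · have : (0 : ℝ) < (2 ^ (j + 5))⁻¹ := by positivity
      refine le_trans (ENNReal.ofReal_le_ofReal (by linarith)) (ih (j + 1) (by omega) (hs'.mono ?_ ?_))
      · have := hsteps j (by omega)
        have e1 : 2 ^ (j + 1) * X = 2 ^ j * X + 2 ^ j * X := by ring
        omega
      · have := hdraws j (by omega)
        have e2 : 2 ^ (j + 1) * Y = 2 ^ j * Y + 2 ^ j * Y := by ring
        omega

end Algorithm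

end Phases

/-! ### Correctness of the initial computations -/

section Preparation

namespace Algorithm

variable {Q : Type u} {ι : Type v} [MeasurableSpace ι]
  {F : RangeSpace Q ι} {O : Oracles F} {w₀ : Measure ι}

lemma le_expect_prepare {d l e : ℕ} {ε δ : ℝ} {f : State Q ι → ℝ≥0∞} {v : ℝ≥0∞}
    (hl : ¬ 2 ^ l * δ < 1) (hl' : ∀ i < l, 2 ^ i * δ < 1)
    (he : ¬ 2 ^ e < d) (he' : ∀ i < e, 2 ^ i < d)
    (hf : ∀ s', Config s' d l e 0 [] 0 (3 * (d + l + e) + 8) 0 → v ≤ f s') :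
    v ≤ expect F w₀ O prepare f (State.init d ε δ) := by
  rw [prepare, expect_seq, expect_setNat, expect_seq]
  refine le_trans ?_ (le_expect_doubling F w₀ O _ _ (by norm_num) (fun i => i < d) d
    ?_ (fun i h => h) (lt_irrefl d) ?_ ?_)
  · rw [expect_seq, expect_setNat, expect_seq]
    refine le_trans ?_ (le_expect_doubling F w₀ O _ _ (by norm_num) (fun i => 2 ^ i * δ < 1) l
      ?_ hl' hl ?_ ?_)
    · rw [expect_seq, expect_setNat, expect_seq]
      refine le_trans ?_ (le_expect_doubling F w₀ O _ _ (by norm_num) (fun i => 2 ^ i < d) e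
        ?_ he' he ?_ ?_)
      · rw [expect_seq, expect_setReal, expect_setNat]
        refine hf _ ?_
        constructor <;>
          simp [State.init, State.tick, State.setNat, State.setReal, NExp.eval, RExp.eval]
        omega
      · intro i m
        simp [BExp.eval, State.init, State.tick, State.setNat, NExp.eval, NExp.reg]
      · simp [State.init, State.tick, State.setNat, NExp.eval]
      · simp [State.init, State.tick, State.setNat, NExp.eval]
    · intro i m
      simp [BExp.eval, State.init, State.tick, State.setNat, NExp.eval, RExp.eval, NExp.reg]
    · simp [State.init, State.tick, State.setNat, NExp.eval]
    · simp [State.init, State.tick, State.setNat, NExp.eval]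
  · intro i m
    simp [BExp.eval, State.init, State.tick, State.setNat, NExp.eval, NExp.reg]
  · simp [State.init, State.tick, State.setNat, NExp.eval]
  · simp [State.init, State.tick, State.setNat, NExp.eval]

end Algorithm

end Preparation

/-! ## Estimates -/

lemma one_le_lg (x : ℝ) : 1 ≤ lg x := le_max_left _ _

lemma natCast_le_lg {n : ℕ} {x : ℝ} (h : 2 ^ n ≤ 4 * x) : (n : ℝ) ≤ 5 * lg x := by
  have hx : 0 < x := by
    have : (0 : ℝ) < 2 ^ n := by positivity
    linarith
  have h1 := Real.log_le_log (by positivity) h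
  rw [Real.log_pow, show (4 : ℝ) = 2 ^ 2 by norm_num, Real.log_mul (by norm_num) hx.ne',
    Real.log_pow] at h1
  have h2 := Real.log_two_gt_d9
  have h3 := Real.log_two_lt_d9
  have h4 := one_le_lg x
  have h5 : Real.log x ≤ lg x := le_max_right _ _
  have h6 : (0 : ℝ) ≤ n := by positivity
  push_cast at h1
  nlinarith

lemma two_pow_le_of_forall_lt {n : ℕ} {x : ℝ} (hx : 1 ≤ x) (h : ∀ i < n, (2 : ℝ) ^ i ≤ x) :
    (2 : ℝ) ^ n ≤ 2 * x := by
  cases n with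
  | zero => rw [pow_zero]; linarith
  | succ n => rw [pow_succ]; linarith [h n (Nat.lt_succ_self n)]

section Bounds

variable {d l e J m : ℕ} {ε δ z : ℝ}

lemma netSize_le {j : ℕ} (hd : 1 ≤ d) (hz : 1 ≤ z) (he : (2 : ℝ) ^ e ≤ 2 * d)
    (hJ : (2 : ℝ) ^ J ≤ 2 * z) (hj : j ≤ J) :
    (netSize d e j : ℝ) ≤ 303104 * (d * z * lg (d * z)) := by
  have hd' : (1 : ℝ) ≤ d := by exact_mod_cast hd
  have h1 : ((e + J : ℕ) : ℝ) ≤ 5 * lg (d * z) := by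
    refine natCast_le_lg ?_
    rw [pow_add]
    calc (2 : ℝ) ^ e * 2 ^ J ≤ (2 * d) * (2 * z) := by gcongr
      _ = _ := by ring
  have h2 := one_le_lg (d * z)
  have h3 : (netSize d e j : ℝ) ≤ netSize d e J := by
    have : netSize d e j ≤ netSize d e J := by unfold netSize; gcongr; norm_num
    exact_mod_cast this
  refine h3.trans ?_
  unfold netSize
  push_cast at h1 ⊢
  calc (4096 * d * 2 ^ J * (e + J + 32) : ℝ) ≤ 4096 * d * (2 * z) * (37 * lg (d * z)) := by
        gcongr
        linarith
    _ = _ := by ring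

/-- The denominator `ε ^ 3 * (1 - ε)` is at most one, so the algorithm need only meet the smaller
bound. -/
lemma le_iterBound (hε : 0 < ε) (hε' : ε < 1) :
    (d * lg (d / ε) * m * lg (m / (ε * δ * (1 - ε))) : ℝ) ≤ iterBound d ε δ m := by
  have h1 := one_le_lg (d / ε)
  have h2 := one_le_lg (m / (ε * δ * (1 - ε)))
  unfold iterBound
  have h3 : (d : ℝ) ≤ d / (ε ^ 3 * (1 - ε)) := by
    rw [le_div_iff₀ (mul_pos (by positivity) (by linarith))]
    have : ε ^ 3 * (1 - ε) ≤ 1 := mul_le_one₀ (pow_le_one₀ hε.le hε'.le) (by linarith) (by linarith)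
    exact mul_le_of_le_one_right (by positivity) this
  gcongr

lemma sampleSize_le (hε : 0 < ε) (hε' : ε < 1) (hJ : (2 : ℝ) ^ J ≤ 2 * m) : (sampleSize d J : ℝ) ≤ 2048 * sampleBound d ε m := by
  have h1 := one_le_lg (m / ε)
  have h2 : (d * 2 ^ d * (m : ℝ) ^ 2 : ℝ) ≤ d * 2 ^ d * (m : ℝ) ^ 2 / ε ^ 2 := by
    rw [le_div_iff₀ (by positivity)]
    exact mul_le_of_le_one_right (by positivity) (pow_le_one₀ hε.le hε'.le)
  have h3 : (d * 2 ^ d * (m : ℝ) ^ 2 : ℝ) ≤ sampleBound d ε m :=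
    h2.trans (le_mul_of_one_le_right (by positivity) h1)
  unfold sampleSize
  push_cast
  calc (512 * d * 2 ^ d * (2 ^ J) ^ 2 : ℝ) ≤ 512 * d * 2 ^ d * (2 * m) ^ 2 := by gcongr
    _ = 2048 * (d * 2 ^ d * (m : ℝ) ^ 2) := by ring
    _ ≤ _ := by gcongr

lemma rounds_le (hε : 0 < ε) (hε' : ε < 1) (hδ : 0 < δ) (hδ' : δ < 1) (hm : 1 ≤ m)
    (hJ : (2 : ℝ) ^ J ≤ 2 * m) (hl : (2 : ℝ) ^ l ≤ 2 * δ⁻¹) :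
    (l + J + 8 : ℝ) ≤ 18 * lg (m / (ε * δ * (1 - ε))) := by
  have hm' : (1 : ℝ) ≤ m := by exact_mod_cast hm
  have h1ε : 0 < 1 - ε := by linarith
  have h1 : ε * δ * (1 - ε) ≤ δ := by
    have : ε * (1 - ε) ≤ 1 := mul_le_one₀ hε'.le h1ε.le (by linarith)
    nlinarith
  have h2 : δ⁻¹ ≤ m / (ε * δ * (1 - ε)) := by
    rw [inv_eq_one_div]
    exact div_le_div₀ (by positivity) hm' (by positivity) h1
  have h3 : (m : ℝ) ≤ m / (ε * δ * (1 - ε)) := by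
    rw [le_div_iff₀ (by positivity)]
    exact mul_le_of_le_one_right (by positivity) (h1.trans hδ'.le)
  have h4 : (l : ℝ) ≤ 5 * lg (m / (ε * δ * (1 - ε))) := natCast_le_lg (by
    have : 0 < δ⁻¹ := by positivity
    linarith)
  have h5 : (J : ℝ) ≤ 5 * lg (m / (ε * δ * (1 - ε))) := natCast_le_lg (by linarith)
  have h6 := one_le_lg (m / (ε * δ * (1 - ε)))
  linarith

lemma steps_le_iterBound (hd : 1 ≤ d) (hε : 0 < ε) (hε' : ε < 1) (hδ : 0 < δ) (hδ' : δ < 1)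
    (hm : 1 ≤ m) (hJ : (2 : ℝ) ^ J ≤ 2 * m) {g : ℕ} (hg : 1 ≤ g) (hl : (2 : ℝ) ^ l ≤ 2 * δ⁻¹)
    (he : (2 : ℝ) ^ e ≤ 2 * d) :
    ((3 * (d + l + e) + 8 + 2 ^ (J + 1) * (12 * g * (256 * (l + J + 8)) + 9)
      + 4 * netSize d e J : ℕ) : ℝ) ≤ 3000000 * (iterBound d ε δ m * g) := by
  have hm' : (1 : ℝ) ≤ m := by exact_mod_cast hm
  have hd' : (1 : ℝ) ≤ d := by exact_mod_cast hd
  have hg' : (1 : ℝ) ≤ g := by exact_mod_cast hg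
  have hr := rounds_le hε hε' hδ hδ' hm hJ hl
  have hK := le_iterBound (d := d) (m := m) (δ := δ) hε hε'
  have hκ := one_le_lg (m / (ε * δ * (1 - ε)))
  have hΛ := one_le_lg (d / ε)
  set κ := lg (m / (ε * δ * (1 - ε)))
  set Λ := lg (d / ε)
  have he' : (e : ℝ) ≤ 5 * Λ := natCast_le_lg (by
    have : (d : ℝ) ≤ d / ε := by
      rw [le_div_iff₀ hε]
      exact mul_le_of_le_one_right (by positivity) hε'.le
    linarith)
  have hl0 : (0 : ℝ) ≤ l := by positivity
  have hJ0 : (0 : ℝ) ≤ J := by positivity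
  set U : ℝ := d * Λ * m * κ with hU
  have hdU : (d : ℝ) ≤ U := by
    calc (d : ℝ) = d * 1 * 1 * 1 := by ring
      _ ≤ U := by rw [hU]; gcongr
  have hΛU : Λ ≤ U := by
    calc Λ = 1 * Λ * 1 * 1 := by ring
      _ ≤ U := by rw [hU]; gcongr
  have hκU : κ ≤ U := by
    calc κ = 1 * 1 * 1 * κ := by ring
      _ ≤ U := by rw [hU]; gcongr
  have hmκU : m * κ ≤ U := by
    calc m * κ = 1 * 1 * m * κ := by ring
      _ ≤ U := by rw [hU]; gcongr
  have hU0 : 0 ≤ U := by positivity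
  have h1 : (3 * (d + l + e) + 8 : ℝ) ≤ 80 * U := by linarith
  have h2 : (2 ^ (J + 1) * (12 * g * (256 * (l + J + 8)) + 9) : ℝ) ≤ 221220 * (U * g) := by
    calc (2 ^ (J + 1) * (12 * g * (256 * (l + J + 8)) + 9) : ℝ)
        ≤ (2 * m * 2) * (12 * g * (256 * (18 * κ)) + 9 * (g * κ)) := by
          rw [pow_succ]
          gcongr
          have : 1 ≤ g * κ := one_le_mul_of_one_le_of_one_le hg' hκ
          linarith
      _ = 221220 * ((m * κ) * g) := by ring
      _ ≤ _ := by gcongr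
  have h3 : (netSize d e J : ℝ) ≤ 450560 * U := by
    unfold netSize
    push_cast
    calc (4096 * d * 2 ^ J * (e + J + 32) : ℝ) ≤ 4096 * d * (2 * m) * (55 * (Λ * κ)) := by
          gcongr
          have : Λ ≤ Λ * κ := le_mul_of_one_le_right (by positivity) hκ
          have : κ ≤ Λ * κ := le_mul_of_one_le_left (by positivity) hΛ
          linarith
      _ = 450560 * U := by rw [hU]; ring
  have h4 : U ≤ U * g := le_mul_of_one_le_right hU0 hg'
  have h5 : U * g ≤ iterBound d ε δ m * g := by gcongr
  push_cast
  linarith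

lemma draws_le_iterBound (hd : 1 ≤ d) (hε : 0 < ε) (hε' : ε < 1) (hδ : 0 < δ) (hδ' : δ < 1)
    (hm : 1 ≤ m) (hJ : (2 : ℝ) ^ J ≤ 2 * m) (hl : (2 : ℝ) ^ l ≤ 2 * δ⁻¹) :
    ((2 ^ (J + 1) * (sampleSize d J * (256 * (l + J + 8))) : ℕ) : ℝ)
      ≤ 40000000 * (iterBound d ε δ m * sampleBound d ε m) := by
  have hr := rounds_le hε hε' hδ hδ' hm hJ hl
  have hK := le_iterBound (d := d) (m := m) (δ := δ) hε hε'
  have hN := sampleSize_le (d := d) hε hε' hJ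
  have hκ := one_le_lg (m / (ε * δ * (1 - ε)))
  have hΛ := one_le_lg (d / ε)
  have hd' : (1 : ℝ) ≤ d := by exact_mod_cast hd
  set κ := lg (m / (ε * δ * (1 - ε)))
  have hmκ : m * κ ≤ iterBound d ε δ m := by
    refine le_trans ?_ hK
    calc m * κ = 1 * 1 * m * κ := by ring
      _ ≤ _ := by gcongr
  have hN0 : 0 ≤ sampleBound d ε m := by
    have : (0 : ℝ) ≤ sampleSize d J := by positivity
    linarith
  have hmκ0 : 0 ≤ m * κ := by positivity
  push_cast
  calc (2 ^ (J + 1) * (sampleSize d J * (256 * (l + J + 8))) : ℝ)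
      ≤ (2 * m * 2) * (2048 * sampleBound d ε m * (256 * (18 * κ))) := by
        rw [pow_succ]
        gcongr
    _ = 37748736 * ((m * κ) * sampleBound d ε m) := by ring
    _ ≤ 40000000 * ((m * κ) * sampleBound d ε m) := by gcongr; norm_num
    _ ≤ _ := by gcongr

end Bounds

end HittingSet

/-! ### The main theorem: combining all phases with the estimates -/

theorem corollary2 :
    ∃ (prog : HittingSet.Cmd) (C : ℝ), 0 < C ∧
      ∀ (Q : Type u) (ι : Type v)
        [MeasurableSpace Q] [StandardBorelSpace Q] [MeasurableSpace ι] [StandardBorelSpace ι]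
        (F : HittingSet.RangeSpace Q ι) (w₀ : Measure ι) [IsFiniteMeasure w₀]
        (O : HittingSet.Oracles F) (d : ℕ) (ε δ : ℝ),
        F.MeasurableIncidence → w₀ ≠ 0 →
        (∃ H : Finset Q, F.IsHittingSet (H : Set Q)) →
        1 ≤ d → F.vcDim ≤ (d : ℕ∞) →
        0 < ε → ε < 1 → 0 < δ → δ < 1 →
        2 / 3 ≤ HittingSet.prob F w₀ O prog (HittingSet.State.init d ε δ)
          {s |
            (s.output.length : ℝ)
                ≤ C * (d * F.fractionalOpt * HittingSet.lg (d * F.fractionalOpt)) ∧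
            (1 - δ) * w₀.real Set.univ ≤ w₀.real (F.hitBy s.output) ∧
            (s.steps : ℝ)
                ≤ C * (HittingSet.iterBound d ε δ F.opt
                    * (F.dual.growth ⌈C * HittingSet.sampleBound d ε F.opt⌉₊ : ℝ)) ∧
            (s.draws : ℝ)
                ≤ C * (HittingSet.iterBound d ε δ F.opt * HittingSet.sampleBound d ε F.opt) ∧
            ((Set.range F.dual.range).Infinite →
              (s.steps : ℝ) + s.draws
                ≤ C * (HittingSet.iterBound d ε δ F.opt
                    * (F.dual.growth ⌈C * HittingSet.sampleBound d ε F.opt⌉₊ : ℝ)))} := by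
  classical
  open HittingSet in
  refine ⟨Algorithm.main, 100000000, by norm_num, ?_⟩
  intro Q ι _ _ _ _ F w₀ _ O d ε δ hF hw hH hd hvc hε hε' hδ hδ'
  have hι : Nonempty ι := by
    by_contra h
    rw [not_nonempty_iff] at h
    exact hw (Measure.eq_zero_of_isEmpty w₀)
  have hz1 := RangeSpace.one_le_fractionalOpt hH
  have hzm := RangeSpace.fractionalOpt_le_opt hH
  have hm : 1 ≤ F.opt := by exact_mod_cast hz1.trans hzm
  have hQ : Nonempty Q := by
    obtain ⟨H, hH⟩ := hH
    obtain ⟨q, -⟩ := hH (Classical.arbitrary ι)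
    exact ⟨q⟩
  obtain ⟨J, hJ, hdeep⟩ := RangeSpace.exists_guess hF hH
  have hJm : (2 : ℝ) ^ J ≤ 2 * F.opt := hJ.trans (by linarith)
  have hexl : ∃ l : ℕ, ¬ 2 ^ l * δ < 1 := by
    obtain ⟨l, hl⟩ := pow_unbounded_of_one_lt δ⁻¹ (one_lt_two : (1 : ℝ) < 2)
    exact ⟨l, not_lt.2 ((inv_le_iff_one_le_mul₀ hδ).1 hl.le)⟩
  have hexe : ∃ e : ℕ, ¬ 2 ^ e < d := ⟨d, not_lt.2 Nat.lt_two_pow_self.le⟩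
  obtain ⟨l, hl, hl'⟩ : ∃ l : ℕ, ¬ 2 ^ l * δ < 1 ∧ ∀ i < l, 2 ^ i * δ < 1 :=
    ⟨Nat.find hexl, Nat.find_spec hexl, fun i hi => not_not.1 (Nat.find_min hexl hi)⟩
  obtain ⟨e, he, he'⟩ : ∃ e : ℕ, ¬ 2 ^ e < d ∧ ∀ i < e, 2 ^ i < d :=
    ⟨Nat.find hexe, Nat.find_spec hexe, fun i hi => not_not.1 (Nat.find_min hexe hi)⟩
  have hlu : (2 : ℝ) ^ l ≤ 2 * δ⁻¹ := two_pow_le_of_forall_lt (one_le_inv₀ hδ |>.2 hδ'.le)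
    fun i hi => by
      rw [← one_div, le_div_iff₀ hδ]
      exact (hl' i hi).le
  have heu : (2 : ℝ) ^ e ≤ 2 * d := two_pow_le_of_forall_lt (by exact_mod_cast hd)
    fun i hi => by exact_mod_cast (he' i hi).le
  set N := sampleBound d ε F.opt
  set r := ⌈100000000 * N⌉₊
  set g := F.dual.growth r
  have hN := sampleSize_le (d := d) hε hε' hJm
  have hN0 : 0 ≤ N := by
    have : (0 : ℝ) ≤ sampleSize d J := by positivity
    linarith
  have hNr : sampleSize d J ≤ r := by
    have : (sampleSize d J : ℝ) ≤ r := (hN.trans (by linarith)).trans (Nat.le_ceil _)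
    exact_mod_cast this
  have hg1 : 1 ≤ g := F.dual.one_le_growth r
  have hK : 0 ≤ iterBound d ε δ F.opt := by
    refine le_trans ?_ (le_iterBound hε hε')
    have h1 := one_le_lg (d / ε)
    have h2 := one_le_lg (F.opt / (ε * δ * (1 - ε)))
    positivity
  have hsteps := steps_le_iterBound hd hε hε' hδ hδ' hm hJm hg1 hlu heu
  have hdraws := draws_le_iterBound hd hε hε' hδ hδ' hm hJm hlu
  -- The guarantee at the start is `1 - 1 / 16 - 1 / 8 = 13 / 16`.
  have h23 : (2 / 3 : ℝ≥0∞) ≤ ENNReal.ofReal (Algorithm.phaseGuarantee 0) := by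
    have : (2 / 3 : ℝ≥0∞) = ENNReal.ofReal (2 / 3) := by
      rw [ENNReal.ofReal_div_of_pos (by norm_num)]; simp
    rw [this]
    refine ENNReal.ofReal_le_ofReal ?_
    norm_num [Algorithm.phaseGuarantee]
  refine h23.trans ?_
  rw [prob, Algorithm.main, expect_seq]
  refine Algorithm.le_expect_prepare hl hl' he he' fun s hs => ?_
  refine le_trans ?_ (loopExp_le_expect F w₀ O _ _ _ _ (J + 2))
  refine Algorithm.le_loopExp_phase hF hw hd hvc (not_lt.1 he) (not_lt.1 hl) (J := J)
    (A₀ := 3 * (d + l + e) + 8) hg1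
    (fun L hL => RangeSpace.length_subsys_le O L (hL.trans hNr)) le_rfl le_rfl
    (fun P => ?_) ?_ J 0 (zero_add J) (hs.mono (Nat.le_add_right _ _) (Nat.zero_le _))
  · have := RangeSpace.isProbabilityMeasure_sampleDist hF w₀ hw P
    exact hdeep _
  · intro s' j hj h1 h2 h3 h4
    have h3' : (s'.steps : ℝ) ≤ 3000000 * (iterBound d ε δ F.opt * g) :=
      (by exact_mod_cast h3 : (s'.steps : ℝ) ≤ _).trans hsteps
    have h4' : (s'.draws : ℝ) ≤ 40000000 * (iterBound d ε δ F.opt * N) :=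
      (by exact_mod_cast h4 : (s'.draws : ℝ) ≤ _).trans hdraws
    have hKg : 0 ≤ iterBound d ε δ F.opt * g := by positivity
    have hKN : 0 ≤ iterBound d ε δ F.opt * N := by positivity
    rw [Set.indicator_of_mem, Pi.one_apply]
    refine ⟨?_, h2, by linarith, by linarith, fun hinf => ?_⟩
    · rw [h1]
      refine (netSize_le hd hz1 heu hJ hj).trans ?_
      have := one_le_lg (d * F.fractionalOpt)
      have h0 : 0 ≤ d * F.fractionalOpt * lg (d * F.fractionalOpt) := by positivity
      linarith
    -- For an infinite dual family the growth function exceeds its argument, so the sample size `N`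
    -- is itself bounded by `g` and the draws are absorbed in the step bound.
    · have hr : r < g := RangeSpace.lt_growth_of_infinite hinf r
      have hNg : N ≤ g := by
        have h5 : 100000000 * N ≤ r := Nat.le_ceil _
        have h6 : (r : ℝ) ≤ g := by exact_mod_cast hr.le
        linarith
      have : iterBound d ε δ F.opt * N ≤ iterBound d ε δ F.opt * g := by gcongr
      linarith
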